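/- Let $M$ be a compact connected finite-dimensional (boundaryless) Riemannian manifold with Riemannian distance and balls $B_\rho(x)$, and let $\mathrm{Leb}$ be a normalised volume on $M$ (a Borel probability measure having a continuous positive density in charts). Let $f:M\to M$ be continuous on a set $Y\subset M$ of full $\mathrm{Leb}$-measure, and suppose there is $x_0\in M$ whose forward orbit $\{f^nx_0:n\ge 0\}$ is dense in $M$ and contained in $Y$. Consider either of the following two situations. (a) *Random maps.* $X$ is a compact metric space, $\omega^*\in X$, $\theta$ is a Borel probability measure on $X$ whose support contains a ball of positive radius around $\omega^*$, and $(x,\omega)\mapsto f_\omega(x)$ is a measurable map $M\times X\to M$ with $f_{\omega^*}=f$. Write $f^x(\omega)=f_\omega(x)$ and $p_x=(f^x)_*\theta$. There are constants $\rho_0>0$ and $\overline q>\underline q>0$ such that for $\mathrm{Leb}$-a.e. $x$: $\operatorname{supp}(p_x)\supset B_{\rho_0}(f(x))$ (if $\omega\mapsto f_\omega(x)$ is continuous, $\operatorname{supp}(p_x)=f^x(\operatorname{supp}\theta)$), and $p_x=q_x\,\mathrm{Leb}$ with $\underline q\le q_x\le\overline q$ $\mathrm{Leb}$-a.e. on $\operatorname{supp}(p_x)$.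 Let $\mu$ be a stationary probability measure, i.e. $\int p_x(A)\,d\mu(x)=\mu(A)$ for every Borel set $A$, such that $p_x\ll\mathrm{Leb}$ also for $\mu$-a.e. $x$. On $(M\times X^{\mathbb N},\ \mathbb P=\mu\times\theta^{\mathbb N})$ let $Z_n(x,\underline\omega)=f_{\omega_n}\circ\cdots\circ f_{\omega_1}(x)$, $Z_0(x,\underline\omega)=x$. (b) *Markov chains.* $(q_x)_{x\in M}$ is a family of positive Hölder continuous probability densities with respect to $\mathrm{Leb}$, varying continuously with $x$ in the $C^0$ topology, and there are $\rho_0>0$ and $\overline q>\underline q>0$ such that $\operatorname{supp}(q_x)\supset B_{\rho_0}(f(x))$ and $\underline q\le q_x\le\overline q$ for every $x\in Y$. Put $p_x=q_x\,\mathrm{Leb}$, let $\mu$ be a stationary probability measure for $(p_x)$, and let $(Z_n)_{n\ge0}$ be any Markov chain, on any probability space with probability $\mathbb P$, with initial law $\mu$ and transition probabilities $(p_x)$ (for instance $Z_n=f^n_{\underline\omega}$ for a representation of $(p_x)$ by random maps). Let $\zeta\in M$ and let $\varphi:M\to\mathbb R\cup\{\pm\infty\}$ be measurable with a global maximum at $\zeta$,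 $\varphi(\zeta)\in\mathbb R\cup\{+\infty\}$, such that $\{\varphi>u\}$ is a topological ball centred at $\zeta$ for all $u<\varphi(\zeta)$ close enough to $\varphi(\zeta)$, and such that $u\mapsto\mu\{\varphi>u\}$ is continuous in a neighbourhood of $\varphi(\zeta)$. Let $X_n=\varphi\circ Z_n$ and $M_n=\max\{X_0,\dots,X_{n-1}\}$. Then for every $\tau>0$ and all real levels $(u_n)$ with $n\,\mathbb P(X_0>u_n)\to\tau$ the following hold. 1. ($D_2(u_n)$) There are $\gamma(n,t)$, nonincreasing in $t$ for each $n$, and $t_n=o(n)$ with $n\gamma(n,t_n)\to0$ such that for all $\ell,t,n$ $$\bigl|\mathbb P(X_0>u_n,\ \max\{X_t,\dots,X_{t+\ell-1}\}\le u_n)-\mathbb P(X_0>u_n)\,\mathbb P(M_\ell\le u_n)\bigr|\le\gamma(n,t).$$ 2. ($D'(u_n)$) For the same $(t_n)$ there are integers $k_n\to\infty$ with $k_nt_n=o(n)$ and $$\lim_{n\to\infty}n\sum_{j=1}^{\lfloor n/k_n\rfloor}\mathbb P(X_0>u_n,\ X_j>u_n)=0.$$ 3. $\mathbb P(M_n\le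 u_n)\to e^{-\tau}$. Moreover $M_n$ has the extreme value law $H(\tau)=1-e^{-\tau}$ ($\tau\ge 0$; $H=0$ on $(-\infty,0)$), i.e. $\bar H(\tau)=1-H(\tau)=e^{-\tau}$: $H$ is a non-degenerate distribution function with $H(0)=0$, and for every $\tau>0$ there are levels $u_n$ with $n\,\mathbb P(X_0>u_n)\to\tau$ and $\mathbb P(M_n\le u_n)\to\bar H(\tau)$. -/

import Mathlib

open MeasureTheory Filter Set Topology
open scoped Manifold ContDiff Bundle ENNReal NNReal

namespace RandomEVL

noncomputable section

/-- `m` is a normalised volume on the manifold `M`: a Borel probability measure which in each chart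
of the atlas has a continuous, strictly positive density with respect to Lebesgue measure. -/
structure IsNormalizedVolume (d : ℕ) {M : Type*} [TopologicalSpace M]
    [ChartedSpace (EuclideanSpace ℝ (Fin d)) M] [MeasurableSpace M] (m : Measure M) : Prop where
  prob : IsProbabilityMeasure m
  density : ∀ e ∈ atlas (EuclideanSpace ℝ (Fin d)) M,
    ∃ ρ : EuclideanSpace ℝ (Fin d) → ℝ, ContinuousOn ρ e.target ∧ (∀ y ∈ e.target, 0 < ρ y) ∧
      ∀ A ⊆ e.source, MeasurableSet A → m A = ∫⁻ y in e '' A, ENNReal.ofReal (ρ y)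

/-- `μ` is stationary for the transition probabilities `(p x)`: `∫ p_x(A) dμ(x) = μ(A)`. -/
def IsStationaryMeasure {M : Type*} [MeasurableSpace M] (p : M → Measure M) (μ : Measure M) : Prop :=
  ∀ A, MeasurableSet A → ∫⁻ x, p x A ∂μ = μ A

/-! ### Random maps -/

/-- The family `f_ω = F · ω`, with noise distribution `θ`, is a uniformly continuous random
perturbation of `f` (with respect to the reference volume `m`).  The transition probability at `x`
is `(f^x)_* θ`, where `f^x ω = F x ω`. When `F x` is continuous, `F x '' θ.support` is the support
of `θ.map (F x)`, so that `cover` says that `f^x(supp θ)` contains the ball. -/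
structure IsRandomPerturbation {M X : Type*} [PseudoMetricSpace M] [MeasurableSpace M]
    [PseudoMetricSpace X] [MeasurableSpace X] (m : Measure M) (f : M → M)
    (F : M → X → M) (ωstar : X) (θ : Measure X) : Prop where
  prob : IsProbabilityMeasure θ
  measurable : Measurable (Function.uncurry F)
  noise_support : ∃ ε₀ > 0, Metric.ball ωstar ε₀ ⊆ θ.support
  unperturbed : ∀ x, F x ωstar = f x
  cover : ∃ ρ₀ > 0, ∀ᵐ x ∂m, Metric.ball (f x) ρ₀ ⊆ (θ.map (F x)).support
  density : ∃ qlow qup : ℝ, 0 < qlow ∧ qlow < qup ∧ ∀ᵐ x ∂m, ∃ q : M → ℝ, Measurable q ∧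
    θ.map (F x) = m.withDensity (fun y => ENNReal.ofReal (q y)) ∧
    ∀ᵐ y ∂m, y ∈ (θ.map (F x)).support → qlow ≤ q y ∧ q y ≤ qup

/-- The random orbit `f_{ω_n} ∘ ⋯ ∘ f_{ω_1} (x)`; the realisation `ω_1, ω_2, …` is indexed from
`0`, that is, `ω_{i+1}` is `w i`. -/
def randomOrbit {M X : Type*} (F : M → X → M) (w : ℕ → X) : ℕ → M → M
  | 0, x => x
  | n + 1, x => F (randomOrbit F w n x) (w n)

/-! ### Markov chains -/

/-- The transition probability `p_x = q_x m`. -/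
def densityTransition {M : Type*} [TopologicalSpace M] [MeasurableSpace M] (m : Measure M)
    (q : C(M, C(M, ℝ))) (x : M) : Measure M :=
  m.withDensity fun y => ENNReal.ofReal (q x y)

/-- The family `(q_x)` of positive Hölder continuous probability densities, which varies
continuously with `x` in the `C⁰` topology (the topology of `C(M, ℝ)`, `M` being compact), is a
perturbation of `f`, uniformly on the set `Y`. -/
structure IsMarkovPerturbation {M : Type*} [PseudoMetricSpace M] [MeasurableSpace M]
    (m : Measure M) (f : M → M) (Y : Set M) (q : C(M, C(M, ℝ))) : Prop where
  pos : ∀ x y, 0 < q x y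
  holder : ∀ x, ∃ C α : ℝ≥0, 0 < α ∧ HolderWith C α (q x)
  prob : ∀ x, ∫ y, q x y ∂m = 1
  cover : ∃ ρ₀ > 0, ∀ x ∈ Y, Metric.ball (f x) ρ₀ ⊆ tsupport (q x)
  bounds : ∃ qlow qup : ℝ, 0 < qlow ∧ qlow < qup ∧ ∀ x ∈ Y, ∀ y, qlow ≤ q x y ∧ q x y ≤ qup

/-- `Z` is, under `P`, a Markov chain with initial distribution `μ` and transition probabilities
`(p x)`: given `Z_0, …, Z_n`, the law of `Z_{n+1}` is `p_{Z_n}`. -/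
structure IsMarkovChain {M Ω : Type*} [MeasurableSpace M] [MeasurableSpace Ω]
    (p : M → Measure M) (μ : Measure M) (P : Measure Ω) (Z : ℕ → Ω → M) : Prop where
  prob : IsProbabilityMeasure P
  measurable : ∀ n, Measurable (Z n)
  initial : P.map (Z 0) = μ
  step : ∀ (n : ℕ) (B : Set (Fin (n + 1) → M)) (A : Set M), MeasurableSet B → MeasurableSet A →
    P {w | (fun i : Fin (n + 1) => Z i w) ∈ B ∧ Z (n + 1) w ∈ A} =
      ∫⁻ w in {w | (fun i : Fin (n + 1) => Z i w) ∈ B}, p (Z n w) A ∂P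

/-! ### The observable -/

/-- `U` is a topological ball centred at `ζ`: an open set which is the homeomorphic image of the
open unit ball of `ℝ^d`, the origin being mapped to `ζ`. -/
def IsTopologicalBall (d : ℕ) {M : Type*} [TopologicalSpace M] (U : Set M) (ζ : M) : Prop :=
  ∃ e : OpenPartialHomeomorph (EuclideanSpace ℝ (Fin d)) M,
    e.source = Metric.ball 0 1 ∧ e.target = U ∧ e 0 = ζ

/-- `φ : M → ℝ ∪ {±∞}` is measurable, has a global maximum at `ζ` (`φ ζ = +∞` is allowed), the sets
`{φ > u}` are topological balls centred at `ζ` for `u < φ ζ` close to `φ ζ`, and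
`μ {φ > u}` is continuous as a function of the level `u` in a neighbourhood of `φ ζ`. -/
structure IsRegularObservable (d : ℕ) {M : Type*} [TopologicalSpace M] [MeasurableSpace M]
    (μ : Measure M) (φ : M → EReal) (ζ : M) : Prop where
  measurable : Measurable φ
  max : ∀ x, φ x ≤ φ ζ
  ne_bot : φ ζ ≠ ⊥
  ball : ∀ᶠ u in 𝓝[<] (φ ζ), IsTopologicalBall d {x | u < φ x} ζ
  continuous : ∀ᶠ u in 𝓝 (φ ζ), ContinuousAt (fun v : EReal => μ {x | v < φ x}) u

/-! ### Extreme values of a stochastic process -/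

section Extremes

variable {Ω : Type*} [MeasurableSpace Ω]

/-- `max {X_t, …, X_{t+ℓ-1}}`, which is `-∞` if `ℓ = 0`. -/
def blockMax (X : ℕ → Ω → EReal) (t ℓ : ℕ) (w : Ω) : EReal :=
  (Finset.Ico t (t + ℓ)).sup fun i => X i w

/-- `M_n = max {X_0, …, X_{n-1}}`. -/
def partialMax (X : ℕ → Ω → EReal) (n : ℕ) (w : Ω) : EReal :=
  (Finset.range n).sup fun i => X i w

/-- The levels `u_n` satisfy `n P(X_0 > u_n) → τ`. -/
def IsNormalizing (P : Measure Ω) (X : ℕ → Ω → EReal) (τ : ℝ) (u : ℕ → ℝ) : Prop :=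
  Tendsto (fun n : ℕ => (n : ℝ) * P.real {w | (u n : EReal) < X 0 w}) atTop (𝓝 τ)

/-- The condition `D₂(u_n)`, with the mixing rates `γ(n,t)` and the sequence `t_n = o(n)`. -/
structure CondD2 (P : Measure Ω) (X : ℕ → Ω → EReal) (u : ℕ → ℝ) (γ : ℕ → ℕ → ℝ)
    (t : ℕ → ℕ) : Prop where
  bound : ∀ ℓ s n : ℕ,
    |P.real {w | (u n : EReal) < X 0 w ∧ blockMax X s ℓ w ≤ (u n : EReal)}
      - P.real {w | (u n : EReal) < X 0 w} * P.real {w | partialMax X ℓ w ≤ (u n : EReal)}|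
      ≤ γ n s
  antitone : ∀ n, Antitone (γ n)
  isLittleO : (fun n : ℕ => (t n : ℝ)) =o[atTop] (fun n : ℕ => (n : ℝ))
  tendsto : Tendsto (fun n : ℕ => (n : ℝ) * γ n (t n)) atTop (𝓝 0)

/-- The condition `D'(u_n)`, relative to the sequence `t_n` of `D₂(u_n)`. -/
def CondD' (P : Measure Ω) (X : ℕ → Ω → EReal) (u : ℕ → ℝ) (t : ℕ → ℕ) : Prop :=
  ∃ k : ℕ → ℕ, Tendsto k atTop atTop ∧
    (fun n : ℕ => (k n : ℝ) * (t n : ℝ)) =o[atTop] (fun n : ℕ => (n : ℝ)) ∧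
    Tendsto (fun n : ℕ => (n : ℝ) * ∑ j ∈ Finset.Icc 1 (n / k n),
      P.real {w | (u n : EReal) < X 0 w ∧ (u n : EReal) < X j w}) atTop (𝓝 0)

/-- `H` is a non-degenerate distribution function with `H 0 = 0`. -/
structure IsNondegenerateDF (H : ℝ → ℝ) : Prop where
  mono : Monotone H
  right_cont : ∀ s, ContinuousWithinAt H (Ici s) s
  atBot : Tendsto H atBot (𝓝 0)
  atTop : Tendsto H atTop (𝓝 1)
  nondegenerate : ∃ s, 0 < H s ∧ H s < 1
  zero : H 0 = 0

/-- `M_n` has the extreme value law `H`. -/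
def HasEVL (P : Measure Ω) (X : ℕ → Ω → EReal) (H : ℝ → ℝ) : Prop :=
  IsNondegenerateDF H ∧ ∀ τ > 0, ∃ u : ℕ → ℝ, IsNormalizing P X τ u ∧
    Tendsto (fun n => P.real {w | partialMax X n w ≤ (u n : EReal)}) atTop (𝓝 (1 - H τ))

/-- The standard exponential distribution function. -/
def stdExpDF (τ : ℝ) : ℝ := if 0 ≤ τ then 1 - Real.exp (-τ) else 0

/-- For all levels `u_n` with `n P(X_0 > u_n) → τ > 0`, both `D₂(u_n)` and `D'(u_n)` hold and
`P(M_n ≤ u_n) → e^{-τ}`; and `M_n` has the standard exponential extreme value law. -/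
def ExponentialExtremes (P : Measure Ω) (X : ℕ → Ω → EReal) : Prop :=
  (∀ τ > 0, ∀ u : ℕ → ℝ, IsNormalizing P X τ u →
    (∃ (γ : ℕ → ℕ → ℝ) (t : ℕ → ℕ), CondD2 P X u γ t ∧ CondD' P X u t) ∧
    Tendsto (fun n => P.real {w | partialMax X n w ≤ (u n : EReal)}) atTop
      (𝓝 (Real.exp (-τ)))) ∧
  HasEVL P X stdExpDF

end Extremes

end

end RandomEVL

open RandomEVL

/-! The noise turns the dynamics into a uniformly ergodic Markov chain, and both situations reduce
to a kernel that is, for almost every x, at most `qup` times the volume and at least `qlow` times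
the volume on balls near f(x).

Doeblin's condition is the geometric core. Shadowing the dense orbit, mass near any point can be
sent near any other, but in an uncontrolled number of steps. Two points coalesce if they can be sent
to a common place in the same time. This is an equivalence relation with open classes, because one
noisy step spreads over all nearby targets; connectedness leaves a single class, which excludes
periodicity. A finite net then gives a common minorant for the N-step transitions
(`exists_minorant`).

The minorant has two consequences. The oscillation of iterated functions shrinks by a fixed factor
every N steps (`oscillation_iterate`), which gives mixing at an exponential rate. Integrated against
the stationary measure μ it also gives m ≤ Cμ (`exists_measure_le`), so transitions are dominated by
μ and two exceedances at distinct times have probability O(p²), where p = P(X₀ > u).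

For the law of the maximum, put G(ℓ) = P(M_ℓ ≤ u). By stationarity G(ℓ) - G(ℓ+1) is the probability
of an exceedance at time 0 followed by ℓ non-exceedances. Opening a gap of length t costs at most
tCp², and mixing then gives G(ℓ+1) ≈ (1-p)G(ℓ). Iterating, G(n) ≈ (1-p)ⁿ → e^{-τ} when np → τ. -/

namespace RandomEVL

/-! ### Exceedance statistics: from mixing and pair correlations to the exponential law. -/

section ExceedanceStatistics

theorem blockMax_le_iff {Ω : Type*} (X : ℕ → Ω → EReal) (t ℓ : ℕ) (w : Ω) (v : EReal) :
    blockMax X t ℓ w ≤ v ↔ ∀ i ∈ Finset.Ico t (t + ℓ), X i w ≤ v := by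
  simp [blockMax, Finset.sup_le_iff]

theorem partialMax_le_iff {Ω : Type*} (X : ℕ → Ω → EReal) (n : ℕ) (w : Ω) (v : EReal) :
    partialMax X n w ≤ v ↔ ∀ i < n, X i w ≤ v := by
  simp [partialMax, Finset.sup_le_iff]

variable {Ω : Type*} [MeasurableSpace Ω]

/-- A process whose exceedances are exponentially mixing and have second order correlations. -/
structure HasMixingExceedances (P : Measure Ω) (X : ℕ → Ω → EReal) (C ρ : ℝ) (N : ℕ) : Prop where
  prob : IsProbabilityMeasure P
  nonneg : 0 ≤ C
  rate_nonneg : 0 ≤ ρ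
  rate_lt_one : ρ < 1
  step_pos : 0 < N
  mixing : ∀ (u : ℝ) (ℓ s : ℕ),
    |P.real {w | (u : EReal) < X 0 w ∧ blockMax X s ℓ w ≤ u}
      - P.real {w | (u : EReal) < X 0 w} * P.real {w | partialMax X ℓ w ≤ u}|
      ≤ P.real {w | (u : EReal) < X 0 w} * ρ ^ (s / N)
  correlation : ∀ (u : ℝ) (j : ℕ), 1 ≤ j →
    P.real {w | (u : EReal) < X 0 w ∧ (u : EReal) < X j w}
      ≤ C * P.real {w | (u : EReal) < X 0 w} ^ 2
  renewal : ∀ (u : ℝ) (ℓ : ℕ), P.real {w | partialMax X ℓ w ≤ u} =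
    P.real {w | partialMax X (ℓ + 1) w ≤ u} +
      P.real {w | (u : EReal) < X 0 w ∧ blockMax X 1 ℓ w ≤ u}

variable {P : Measure Ω} {X : ℕ → Ω → EReal} {C ρ : ℝ} {N : ℕ}

namespace HasMixingExceedances

/-- If the first event holds and the second fails, an exceedance occurs at some index of J besides
the one at time 0; each such pair costs at most Cp². -/
theorem exceedance_block_le_add (h : HasMixingExceedances P X C ρ N) (u : ℝ) (ℓ s s' r : ℕ)
    (J : Finset ℕ) (hJ : ∀ j ∈ J, 1 ≤ j) (hcard : J.card ≤ r)
    (hsub : Finset.Ico s' (s' + ℓ) ⊆ Finset.Ico s (s + ℓ) ∪ J) :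
    P.real {w | (u : EReal) < X 0 w ∧ blockMax X s ℓ w ≤ u} ≤
      P.real {w | (u : EReal) < X 0 w ∧ blockMax X s' ℓ w ≤ u} +
        r * (C * P.real {w | (u : EReal) < X 0 w} ^ 2) := by
  have := h.prob
  have hC : 0 ≤ C * P.real {w | (u : EReal) < X 0 w} ^ 2 := mul_nonneg h.nonneg (sq_nonneg _)
  have hincl : {w | (u : EReal) < X 0 w ∧ blockMax X s ℓ w ≤ u} ⊆
      {w | (u : EReal) < X 0 w ∧ blockMax X s' ℓ w ≤ u} ∪
        ⋃ j ∈ J, {w | (u : EReal) < X 0 w ∧ (u : EReal) < X j w} := by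
    rintro w ⟨h0, hb⟩
    by_cases hw : blockMax X s' ℓ w ≤ u
    · exact Or.inl ⟨h0, hw⟩
    · right
      rw [blockMax_le_iff] at hw hb
      push Not at hw
      obtain ⟨i, hi, hiu⟩ := hw
      rcases Finset.mem_union.1 (hsub hi) with h1 | h1
      · exact absurd (hb i h1) (not_le.2 hiu)
      · exact mem_iUnion₂.2 ⟨i, h1, h0, hiu⟩
  calc _ ≤ _ := measureReal_mono hincl
    _ ≤ _ := measureReal_union_le _ _
    _ ≤ _ := by
      gcongr
      calc _ ≤ ∑ j ∈ J, P.real {w | (u : EReal) < X 0 w ∧ (u : EReal) < X j w} :=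
            measureReal_biUnion_finset_le _ _
        _ ≤ ∑ j ∈ J, C * P.real {w | (u : EReal) < X 0 w} ^ 2 :=
            Finset.sum_le_sum fun j hj => h.correlation u j (hJ j hj)
        _ = J.card * (C * P.real {w | (u : EReal) < X 0 w} ^ 2) := by simp
        _ ≤ _ := by gcongr

theorem abs_exceedance_block_sub_le (h : HasMixingExceedances P X C ρ N) (u : ℝ) (ℓ t : ℕ)
    (ht : 1 ≤ t) :
    |P.real {w | (u : EReal) < X 0 w ∧ blockMax X 1 ℓ w ≤ u} -
      P.real {w | (u : EReal) < X 0 w ∧ blockMax X t ℓ w ≤ u}| ≤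
        t * (C * P.real {w | (u : EReal) < X 0 w} ^ 2) := by
  -- The windows starting at 1 and at t differ by at most t - 1 indices at either end.
  have h1 := h.exceedance_block_le_add u ℓ 1 t t (Finset.Ico (1 + ℓ) (t + ℓ))
    (fun j hj => by simp at hj; omega) (by simp) (fun j hj => by simp at hj ⊢; omega)
  have h2 := h.exceedance_block_le_add u ℓ t 1 t (Finset.Ico 1 t)
    (fun j hj => by simp at hj; omega) (by simp) (fun j hj => by simp at hj ⊢; omega)
  rw [abs_le]; constructor <;> linarith

/-- Renewal identity, then a gap of length t opened by shifting the block, then mixing across the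
gap. -/
theorem abs_partialMax_succ_sub_le (h : HasMixingExceedances P X C ρ N) (u : ℝ) (ℓ t : ℕ)
    (ht : 1 ≤ t) :
    |P.real {w | partialMax X (ℓ + 1) w ≤ u} -
      (1 - P.real {w | (u : EReal) < X 0 w}) * P.real {w | partialMax X ℓ w ≤ u}| ≤
        P.real {w | (u : EReal) < X 0 w} *
          (t * (C * P.real {w | (u : EReal) < X 0 w}) + ρ ^ (t / N)) := by
  have h1 := h.abs_exceedance_block_sub_le u ℓ t ht
  have h2 := h.mixing u ℓ t
  have h3 := h.renewal u ℓ
  rw [abs_le] at *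
  constructor <;> nlinarith

/-- Multiplication by 1 - p ∈ [0, 1] does not expand, so the one-step errors merely add up. -/
theorem abs_partialMax_sub_pow_le (h : HasMixingExceedances P X C ρ N) (u : ℝ) (t : ℕ)
    (ht : 1 ≤ t) (ℓ : ℕ) :
    |P.real {w | partialMax X ℓ w ≤ u} - (1 - P.real {w | (u : EReal) < X 0 w}) ^ ℓ| ≤
      ℓ * (P.real {w | (u : EReal) < X 0 w} *
          (t * (C * P.real {w | (u : EReal) < X 0 w}) + ρ ^ (t / N))) := by
  have := h.prob
  induction ℓ with
  | zero => simp [partialMax]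
  | succ ℓ ih =>
    have h1 := h.abs_partialMax_succ_sub_le u ℓ t ht
    set p := P.real {w | (u : EReal) < X 0 w}
    set G := P.real {w | partialMax X ℓ w ≤ u}
    set G' := P.real {w | partialMax X (ℓ + 1) w ≤ u}
    have hp0 : 0 ≤ p := measureReal_nonneg
    have hp1 : p ≤ 1 := measureReal_le_one
    have h2 : |(1 - p) * (G - (1 - p) ^ ℓ)| ≤ |G - (1 - p) ^ ℓ| := by
      rw [abs_mul, abs_of_nonneg (by linarith)]
      exact mul_le_of_le_one_left (abs_nonneg _) (by linarith)
    have h3 : G' - (1 - p) ^ (ℓ + 1) = (G' - (1 - p) * G) + (1 - p) * (G - (1 - p) ^ ℓ) := by ring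
    rw [h3]
    refine (abs_add_le _ _).trans ?_
    push_cast
    linarith

end HasMixingExceedances

/-- The gap lengths used in the block conditions: the integer part of the fourth root. -/
def fourthRoot (n : ℕ) : ℕ := Nat.sqrt (Nat.sqrt n)

theorem tendsto_nat_sqrt_atTop : Tendsto Nat.sqrt atTop atTop :=
  tendsto_atTop.2 fun b => (eventually_ge_atTop (b * b)).mono fun _ hn => Nat.le_sqrt.2 hn

theorem tendsto_fourthRoot_atTop : Tendsto fourthRoot atTop atTop :=
  tendsto_nat_sqrt_atTop.comp tendsto_nat_sqrt_atTop

theorem fourthRoot_mul_self_le (n : ℕ) : fourthRoot n * fourthRoot n ≤ Nat.sqrt n :=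
  Nat.sqrt_le _

theorem nat_sqrt_isLittleO : (fun n : ℕ => (Nat.sqrt n : ℝ)) =o[atTop] (fun n : ℕ => (n : ℝ)) := by
  rw [Asymptotics.isLittleO_iff]
  intro c hc
  have h : Tendsto (fun n : ℕ => (Nat.sqrt n : ℝ)) atTop atTop :=
    tendsto_natCast_atTop_atTop.comp tendsto_nat_sqrt_atTop
  filter_upwards [h.eventually_ge_atTop c⁻¹] with n hn
  have h1 : (Nat.sqrt n : ℝ) * Nat.sqrt n ≤ n := by exact_mod_cast Nat.sqrt_le n
  rw [Real.norm_of_nonneg (by positivity), Real.norm_of_nonneg (by positivity)]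
  calc (Nat.sqrt n : ℝ) = c * (c⁻¹ * Nat.sqrt n) := by field_simp
    _ ≤ c * (Nat.sqrt n * Nat.sqrt n) := by gcongr
    _ ≤ c * n := by gcongr

theorem fourthRoot_mul_self_isLittleO :
    (fun n : ℕ => (fourthRoot n : ℝ) * (fourthRoot n : ℝ)) =o[atTop] (fun n : ℕ => (n : ℝ)) := by
  refine (Asymptotics.IsBigO.of_bound 1 (Eventually.of_forall fun n => ?_)).trans_isLittleO
    nat_sqrt_isLittleO
  rw [Real.norm_of_nonneg (by positivity), Real.norm_of_nonneg (by positivity), one_mul]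
  exact_mod_cast fourthRoot_mul_self_le n

theorem fourthRoot_isLittleO :
    (fun n : ℕ => (fourthRoot n : ℝ)) =o[atTop] (fun n : ℕ => (n : ℝ)) := by
  refine (Asymptotics.IsBigO.of_bound 1 (Eventually.of_forall fun n => ?_)).trans_isLittleO
    fourthRoot_mul_self_isLittleO
  rw [Real.norm_of_nonneg (by positivity), Real.norm_of_nonneg (by positivity), one_mul]
  exact_mod_cast Nat.le_mul_self _

theorem tendsto_pow_fourthRoot_div {ρ : ℝ} (h0 : 0 ≤ ρ) (h1 : ρ < 1) {N : ℕ} (hN : 0 < N) :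
    Tendsto (fun n => ρ ^ (fourthRoot n / N)) atTop (𝓝 0) := by
  refine (tendsto_pow_atTop_nhds_zero_of_lt_one h0 h1).comp ?_
  exact (Nat.tendsto_div_const_atTop hN.ne').comp tendsto_fourthRoot_atTop

namespace HasMixingExceedances

variable {τ : ℝ} {u : ℕ → ℝ}

theorem condD2 (h : HasMixingExceedances P X C ρ N) (hu : IsNormalizing P X τ u) :
    CondD2 P X u (fun n s => P.real {w | (u n : EReal) < X 0 w} * ρ ^ (s / N)) fourthRoot where
  bound ℓ s n := h.mixing (u n) ℓ s
  antitone _ _ _ hs := mul_le_mul_of_nonneg_left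
    (pow_le_pow_of_le_one h.rate_nonneg h.rate_lt_one.le (Nat.div_le_div_right hs))
    measureReal_nonneg
  isLittleO := fourthRoot_isLittleO
  tendsto := by
    have := Tendsto.mul hu (tendsto_pow_fourthRoot_div h.rate_nonneg h.rate_lt_one h.step_pos)
    simpa only [mul_zero, mul_assoc] using this

/-- With p = P(X₀ > uₙ), the sum has at most n/kₙ terms of size Cp², so n times it is at most
C(np)²/kₙ. Choosing kₙ = tₙ ≈ n^{1/4} keeps kₙtₙ below √n. -/
theorem condD' (h : HasMixingExceedances P X C ρ N) (hu : IsNormalizing P X τ u) :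
    CondD' P X u fourthRoot := by
  refine ⟨fourthRoot, tendsto_fourthRoot_atTop, fourthRoot_mul_self_isLittleO, ?_⟩
  have hinv : Tendsto (fun n => ((fourthRoot n : ℝ))⁻¹) atTop (𝓝 0) :=
    tendsto_inv_atTop_zero.comp (tendsto_natCast_atTop_atTop.comp tendsto_fourthRoot_atTop)
  have hlim := ((hu.mul hu).mul hinv).const_mul C
  simp only [mul_zero] at hlim
  refine squeeze_zero (fun n => by positivity) (fun n => ?_) hlim
  set p := P.real {w | (u n : EReal) < X 0 w}
  have hp : 0 ≤ C * p ^ 2 := mul_nonneg h.nonneg (sq_nonneg _)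
  calc (n : ℝ) * ∑ j ∈ Finset.Icc 1 (n / fourthRoot n),
        P.real {w | (u n : EReal) < X 0 w ∧ (u n : EReal) < X j w}
      ≤ n * ∑ j ∈ Finset.Icc 1 (n / fourthRoot n), C * p ^ 2 := by
        gcongr with j hj
        exact h.correlation _ _ (Finset.mem_Icc.1 hj).1
    _ = n * ((n / fourthRoot n : ℕ) * (C * p ^ 2)) := by simp
    _ ≤ n * ((n / fourthRoot n) * (C * p ^ 2)) := by
        gcongr; exact Nat.cast_div_le
    _ = _ := by ring

/-- For p = P(X₀ > uₙ) and gap t = tₙ, the accumulated error is np · (C(t/n)(np) + ρ^(t/N)), where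
np → τ, t/n → 0 and t → ∞. -/
theorem tendsto_partialMax (h : HasMixingExceedances P X C ρ N) (hu : IsNormalizing P X τ u) :
    Tendsto (fun n => P.real {w | partialMax X n w ≤ (u n : EReal)}) atTop
      (𝓝 (Real.exp (-τ))) := by
  have hpow : Tendsto (fun n : ℕ => (1 - P.real {w | (u n : EReal) < X 0 w}) ^ n) atTop
      (𝓝 (Real.exp (-τ))) := by
    have : Tendsto (fun n : ℕ => (n : ℝ) * -P.real {w | (u n : EReal) < X 0 w}) atTop
        (𝓝 (-τ)) := by simpa using hu.neg
    simpa [sub_eq_add_neg] using Real.tendsto_one_add_pow_exp_of_tendsto this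
  have ht : Tendsto (fun n : ℕ => (fourthRoot n : ℝ) / n) atTop (𝓝 0) :=
    fourthRoot_isLittleO.tendsto_div_nhds_zero
  have herr := hu.mul ((((ht.mul hu).const_mul C)).add
    (tendsto_pow_fourthRoot_div h.rate_nonneg h.rate_lt_one h.step_pos))
  simp only [zero_mul, mul_zero, add_zero] at herr
  have hdiff : Tendsto (fun n => P.real {w | partialMax X n w ≤ (u n : EReal)} -
      (1 - P.real {w | (u n : EReal) < X 0 w}) ^ n) atTop (𝓝 0) := by
    refine squeeze_zero_norm' ?_ herr
    filter_upwards [tendsto_fourthRoot_atTop.eventually_ge_atTop 1, eventually_gt_atTop 0]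
      with n hn hn0
    have hn0' : (n : ℝ) ≠ 0 := by positivity
    refine (h.abs_partialMax_sub_pow_le (u n) (fourthRoot n) hn n).trans_eq ?_
    field_simp
  simpa using hdiff.add hpow

end HasMixingExceedances

theorem stdExpDF_isNondegenerateDF : IsNondegenerateDF stdExpDF := by
  -- This single formula shows monotonicity and continuity at once.
  have hmax : stdExpDF = fun s => 1 - Real.exp (-(max s 0)) := by
    funext s
    unfold stdExpDF
    split_ifs with hs
    · rw [max_eq_left hs]
    · rw [max_eq_right (not_le.1 hs).le]; simp
  refine ⟨?_, ?_, ?_, ?_, ⟨1, ?_, ?_⟩, by simp [stdExpDF]⟩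
  · rw [hmax]
    intro a b hab
    dsimp only
    gcongr
  · intro s
    rw [hmax]
    exact Continuous.continuousWithinAt (by fun_prop)
  · refine tendsto_const_nhds.congr' ?_
    filter_upwards [eventually_lt_atBot 0] with s hs
    simp [stdExpDF, not_le.2 hs]
  · have : Tendsto (fun s : ℝ => 1 - Real.exp (-s)) atTop (𝓝 (1 - 0)) :=
      tendsto_const_nhds.sub (Real.tendsto_exp_neg_atTop_nhds_zero)
    rw [sub_zero] at this
    refine this.congr' ?_
    filter_upwards [eventually_ge_atTop 0] with s hs
    simp [stdExpDF, hs]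
  · simp [stdExpDF]
  · simp [stdExpDF, Real.exp_pos]

theorem HasMixingExceedances.exponentialExtremes (h : HasMixingExceedances P X C ρ N)
    (hlev : ∀ τ > 0, ∃ u : ℕ → ℝ, IsNormalizing P X τ u) : ExponentialExtremes P X := by
  refine ⟨fun τ _ u hu => ⟨⟨_, _, h.condD2 hu, h.condD' hu⟩, h.tendsto_partialMax hu⟩,
    stdExpDF_isNondegenerateDF, fun τ hτ => ?_⟩
  obtain ⟨u, hu⟩ := hlev τ hτ
  refine ⟨u, hu, ?_⟩
  simpa [stdExpDF, le_of_lt hτ] using h.tendsto_partialMax hu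

/-- Levels with prescribed tails: if the tail of `φ` under `μ` is continuous near the maximal value
of `φ` and positive below it, then every `τ > 0` is a normalised limit. -/
theorem exists_levels {M : Type*} [MeasurableSpace M] {μ : Measure M} [IsProbabilityMeasure μ]
    {φ : M → EReal} {ζ : M} (hmax : ∀ x, φ x ≤ φ ζ) (hbot : φ ζ ≠ ⊥)
    (hpos : ∀ᶠ u in 𝓝[<] (φ ζ), 0 < μ {x | u < φ x})
    (hcont : ∀ᶠ u in 𝓝 (φ ζ), ContinuousAt (fun v : EReal => μ {x | v < φ x}) u)
    {τ : ℝ} (hτ : 0 < τ) :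
    ∃ u : ℕ → ℝ, Tendsto (fun n : ℕ => (n : ℝ) * μ.real {x | (u n : EReal) < φ x}) atTop
      (𝓝 τ) := by
  have hlt : ⊥ < φ ζ := bot_lt_iff_ne_bot.2 hbot
  obtain ⟨a, ha, hac⟩ := exists_Ioc_subset_of_mem_nhds hcont ⟨⊥, hlt⟩
  obtain ⟨b, hb, hbp⟩ := (mem_nhdsLT_iff_exists_Ioo_subset' hlt).1 hpos
  obtain ⟨v, hv, hvζ⟩ := exists_between (max_lt ha hb)
  have hva : a < v := (le_max_left _ _).trans_lt hv
  have hvb : b < v := (le_max_right _ _).trans_lt hv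
  have hvpos : 0 < μ {x | v < φ x} := hbp ⟨hvb, hvζ⟩
  set T : EReal → ℝ≥0∞ := fun v => μ {x | v < φ x} with hT
  have hTζ : T (φ ζ) = 0 := by
    have : {x | φ ζ < φ x} = ∅ := by ext x; simpa using hmax x
    simp [hT, this]
  have hTcont : ContinuousOn T (Icc v (φ ζ)) := fun w hw =>
    (hac ⟨hva.trans_le hw.1, hw.2⟩).continuousWithinAt
  have hivt := intermediate_value_Icc' hvζ.le hTcont
  rw [hTζ] at hivt
  have key : ∀ n : ℕ, ∃ u : ℝ, (0 < n ∧ ENNReal.ofReal (τ / n) ≤ T v) →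
      μ {x | (u : EReal) < φ x} = ENNReal.ofReal (τ / n) := by
    intro n
    by_cases hn : 0 < n ∧ ENNReal.ofReal (τ / n) ≤ T v
    · obtain ⟨w, hw, hwT⟩ := hivt ⟨zero_le, hn.2⟩
      have hτn : 0 < τ / n := div_pos hτ (by exact_mod_cast hn.1)
      have hwζ : w ≠ φ ζ := by
        rintro rfl
        rw [hTζ] at hwT
        -- The tail vanishes at the maximum but equals τ/n > 0 at w. Hence w lies strictly below the
        -- maximum, and above a, so it is a real number.
        exact (ENNReal.ofReal_pos.2 hτn).ne hwT
      have hw1 : w ≠ ⊤ := ((lt_of_le_of_ne hw.2 hwζ).trans_le le_top).ne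
      have hw2 : w ≠ ⊥ := (((bot_le).trans_lt hva).trans_le hw.1).ne'
      refine ⟨w.toReal, fun _ => ?_⟩
      rw [EReal.coe_toReal hw1 hw2]
      exact hwT
    -- Only finitely many n are affected, so any level will do.
    · exact ⟨0, fun h => absurd h hn⟩
  choose u hu using key
  refine ⟨u, tendsto_const_nhds.congr' ?_⟩
  have hsmall : Tendsto (fun n : ℕ => ENNReal.ofReal (τ / n)) atTop (𝓝 0) := by
    have := ENNReal.tendsto_ofReal (tendsto_const_div_atTop_nhds_zero_nat τ)
    simpa using this
  filter_upwards [hsmall.eventually_lt_const hvpos, eventually_gt_atTop 0] with n h1 h2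
  rw [measureReal_def, hu n ⟨h2, h1.le⟩, ENNReal.toReal_ofReal (by positivity)]
  field_simp

end ExceedanceStatistics

open ProbabilityTheory

/-! ### Transition operators and avoidance probabilities. -/

section Transfer

variable {M : Type*} [MeasurableSpace M]

/-- The transition operator of a kernel, acting on functions. -/
noncomputable def transfer (κ : Kernel M M) (g : M → ℝ≥0∞) (x : M) : ℝ≥0∞ := ∫⁻ y, g y ∂κ x

variable {κ : Kernel M M} {μ : Measure M}

theorem measurable_transfer {g : M → ℝ≥0∞} (hg : Measurable g) : Measurable (transfer κ g) :=
  hg.lintegral_kernel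

theorem measurable_iterate_transfer {g : M → ℝ≥0∞} (hg : Measurable g) (n : ℕ) :
    Measurable ((transfer κ)^[n] g) := by
  induction n with
  | zero => exact hg
  | succ n ih => rw [Function.iterate_succ_apply']; exact measurable_transfer ih

theorem iterate_transfer_mono {g h : M → ℝ≥0∞} (hgh : g ≤ h) (n : ℕ) :
    (transfer κ)^[n] g ≤ (transfer κ)^[n] h :=
  Monotone.iterate (f := transfer κ) (fun _ _ H _ => lintegral_mono H) n hgh

theorem iterate_transfer_add {g h : M → ℝ≥0∞} (hg : Measurable g) (n : ℕ) :
    (transfer κ)^[n] (g + h) = (transfer κ)^[n] g + (transfer κ)^[n] h := by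
  induction n generalizing g h with
  | zero => rfl
  | succ n ih =>
    have : transfer κ (g + h) = transfer κ g + transfer κ h := by
      funext x
      exact lintegral_add_left hg h
    simp only [Function.iterate_succ_apply, this, ih (measurable_transfer hg)]

theorem iterate_transfer_const [IsMarkovKernel κ] (c : ℝ≥0∞) (n : ℕ) :
    (transfer κ)^[n] (fun _ => c) = fun _ => c := by
  induction n with
  | zero => rfl
  | succ n ih =>
    rw [Function.iterate_succ_apply', ih]
    funext x
    simp [transfer]

theorem IsStationaryMeasure.bind_eq (h : IsStationaryMeasure κ μ) : μ.bind κ = μ := by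
  ext A hA
  rw [Measure.bind_apply hA κ.measurable.aemeasurable]
  exact h A hA

theorem IsStationaryMeasure.lintegral_transfer (h : IsStationaryMeasure κ μ) {g : M → ℝ≥0∞}
    (hg : Measurable g) : ∫⁻ x, transfer κ g x ∂μ = ∫⁻ x, g x ∂μ := by
  conv_rhs => rw [← h.bind_eq]
  rw [Measure.lintegral_bind κ.measurable.aemeasurable hg.aemeasurable]
  rfl

theorem IsStationaryMeasure.lintegral_iterate_transfer (h : IsStationaryMeasure κ μ)
    {g : M → ℝ≥0∞} (hg : Measurable g) (n : ℕ) :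
    ∫⁻ x, (transfer κ)^[n] g x ∂μ = ∫⁻ x, g x ∂μ := by
  induction n with
  | zero => rfl
  | succ n ih =>
    rw [Function.iterate_succ_apply', h.lintegral_transfer (measurable_iterate_transfer hg n), ih]

/-- Since μκ = μ, a μ-null set is null for κ x for μ-almost every x. This lets estimates known only
almost everywhere be iterated. -/
theorem IsStationaryMeasure.ae_transition (h : IsStationaryMeasure κ μ) {p : M → Prop}
    (hp : ∀ᵐ y ∂μ, p y) : ∀ᵐ x ∂μ, ∀ᵐ y ∂κ x, p y := by
  rw [← h.bind_eq] at hp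
  exact Measure.ae_ae_of_ae_bind κ.measurable.aemeasurable hp

theorem IsStationaryMeasure.iterate_transfer_congr (h : IsStationaryMeasure κ μ)
    {g g' : M → ℝ≥0∞} (hg : g =ᵐ[μ] g') (n : ℕ) :
    (transfer κ)^[n] g =ᵐ[μ] (transfer κ)^[n] g' := by
  induction n with
  | zero => exact hg
  | succ n ih =>
    rw [Function.iterate_succ_apply', Function.iterate_succ_apply']
    filter_upwards [h.ae_transition ih] with x hx
    exact lintegral_congr_ae hx

/-- The probability that the first `ℓ` points of the chain started at a given point avoid `A`. -/
noncomputable def avoidance (κ : Kernel M M) (A : Set M) : ℕ → M → ℝ≥0∞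
  | 0 => fun _ => 1
  | ℓ + 1 => Aᶜ.indicator (transfer κ (avoidance κ A ℓ))

theorem measurable_avoidance {A : Set M} (hA : MeasurableSet A) (ℓ : ℕ) :
    Measurable (avoidance κ A ℓ) := by
  induction ℓ with
  | zero => exact measurable_const
  | succ ℓ ih => exact (measurable_transfer ih).indicator hA.compl

theorem avoidance_le_one [IsMarkovKernel κ] (A : Set M) (ℓ : ℕ) (x : M) :
    avoidance κ A ℓ x ≤ 1 := by
  induction ℓ generalizing x with
  | zero => exact le_rfl
  | succ ℓ ih =>
    refine (indicator_le_self _ _ x).trans ?_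
    calc transfer κ (avoidance κ A ℓ) x ≤ ∫⁻ _, 1 ∂κ x := lintegral_mono ih
      _ = 1 := by simp

end Transfer

/-! ### Stationary Markov chains: path probabilities through the transition operator. -/

section Chain

variable {M Ω : Type*} [MeasurableSpace M] [MeasurableSpace Ω] {κ : Kernel M M} {μ : Measure M}
  {P : Measure Ω} {Z : ℕ → Ω → M}

/-- `S` is an event depending on `Z_0, …, Z_n` only. -/
def IsPastEvent (Z : ℕ → Ω → M) (n : ℕ) (S : Set Ω) : Prop :=
  ∃ B : Set (Fin (n + 1) → M), MeasurableSet B ∧ S = {w | (fun i : Fin (n + 1) => Z i w) ∈ B}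

omit [MeasurableSpace Ω] in
theorem IsPastEvent.succ {n : ℕ} {S : Set Ω} (h : IsPastEvent Z n S) :
    IsPastEvent Z (n + 1) S := by
  obtain ⟨B, hB, rfl⟩ := h
  refine ⟨(fun z : Fin (n + 2) → M => fun i : Fin (n + 1) => z i.castSucc) ⁻¹' B,
    hB.preimage (by fun_prop), rfl⟩

omit [MeasurableSpace Ω] in
theorem IsPastEvent.of_le {n m : ℕ} {S : Set Ω} (h : IsPastEvent Z n S) (hnm : n ≤ m) :
    IsPastEvent Z m S :=
  Nat.le_induction h (fun _ _ ih => ih.succ) m hnm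

omit [MeasurableSpace Ω] in
theorem isPastEvent_preimage (n : ℕ) {A : Set M} (hA : MeasurableSet A) :
    IsPastEvent Z n (Z n ⁻¹' A) :=
  ⟨(fun z : Fin (n + 1) → M => z (Fin.last n)) ⁻¹' A, hA.preimage (by fun_prop), by ext; simp⟩

omit [MeasurableSpace Ω] in
theorem IsPastEvent.inter {n : ℕ} {S T : Set Ω} (hS : IsPastEvent Z n S)
    (hT : IsPastEvent Z n T) : IsPastEvent Z n (S ∩ T) := by
  obtain ⟨B, hB, rfl⟩ := hS
  obtain ⟨B', hB', rfl⟩ := hT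
  exact ⟨B ∩ B', hB.inter hB', rfl⟩

omit [MeasurableSpace Ω] in
theorem isPastEvent_univ (n : ℕ) : IsPastEvent Z n univ := ⟨univ, .univ, by simp⟩

namespace IsMarkovChain

theorem measure_past_inter (h : IsMarkovChain κ μ P Z) {n : ℕ} {S : Set Ω}
    (hS : IsPastEvent Z n S) {A : Set M} (hA : MeasurableSet A) :
    P (S ∩ Z (n + 1) ⁻¹' A) = ∫⁻ w in S, κ (Z n w) A ∂P := by
  obtain ⟨B, hB, rfl⟩ := hS
  exact h.step n B A hB hA

/-- On a past event S, the Markov property says that the law of the next state is the law of the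
present one transported by κ. -/
theorem setLIntegral_succ (h : IsMarkovChain κ μ P Z) {n : ℕ} {S : Set Ω}
    (hS : IsPastEvent Z n S) {g : M → ℝ≥0∞} (hg : Measurable g) :
    ∫⁻ w in S, g (Z (n + 1) w) ∂P = ∫⁻ w in S, transfer κ g (Z n w) ∂P := by
  have hlaw : (P.restrict S).map (Z (n + 1)) = ((P.restrict S).map (Z n)).bind κ := by
    ext A hA
    rw [Measure.map_apply (h.measurable _) hA, Measure.restrict_apply ((h.measurable _) hA),
      inter_comm, h.measure_past_inter hS hA,
      Measure.bind_apply hA κ.measurable.aemeasurable,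
      lintegral_map (κ.measurable_coe hA) (h.measurable n)]
  rw [← lintegral_map hg (h.measurable _), hlaw,
    Measure.lintegral_bind κ.measurable.aemeasurable hg.aemeasurable,
    lintegral_map hg.lintegral_kernel (h.measurable n)]
  rfl

theorem setLIntegral_add (h : IsMarkovChain κ μ P Z) {n : ℕ} {S : Set Ω}
    (hS : IsPastEvent Z n S) {g : M → ℝ≥0∞} (hg : Measurable g) (k : ℕ) :
    ∫⁻ w in S, g (Z (n + k) w) ∂P = ∫⁻ w in S, (transfer κ)^[k] g (Z n w) ∂P := by
  induction k generalizing g with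
  | zero => rfl
  | succ k ih =>
    rw [Function.iterate_succ_apply, ← ih (measurable_transfer hg)]
    exact h.setLIntegral_succ (hS.of_le (Nat.le_add_right n k)) hg

/-- The condition that Z n avoids A is absorbed into the past event, which is why the induction
keeps n and S general. -/
theorem measure_past_avoid (h : IsMarkovChain κ μ P Z) {A : Set M} (hA : MeasurableSet A)
    (ℓ : ℕ) {n : ℕ} {S : Set Ω} (hS : IsPastEvent Z n S) :
    P (S ∩ {w | ∀ i ∈ Finset.Ico n (n + ℓ), Z i w ∉ A}) =
      ∫⁻ w in S, avoidance κ A ℓ (Z n w) ∂P := by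
  induction ℓ generalizing n S with
  | zero => simp [avoidance]
  | succ ℓ ih =>
    have hS' : IsPastEvent Z n (S ∩ Z n ⁻¹' Aᶜ) := hS.inter (isPastEvent_preimage n hA.compl)
    have hset : S ∩ {w | ∀ i ∈ Finset.Ico n (n + (ℓ + 1)), Z i w ∉ A} =
        (S ∩ Z n ⁻¹' Aᶜ) ∩ {w | ∀ i ∈ Finset.Ico (n + 1) (n + 1 + ℓ), Z i w ∉ A} := by
      ext w
      simp only [Finset.mem_Ico, mem_inter_iff, mem_ofPred_eq, mem_preimage, mem_compl_iff,
        and_assoc, and_congr_right_iff]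
      intro _
      refine ⟨fun H => ⟨H n ⟨le_rfl, by omega⟩, fun i hi => H i ⟨by omega, by omega⟩⟩,
        fun H i hi => ?_⟩
      rcases hi.1.eq_or_lt with rfl | hlt
      · exact H.1
      · exact H.2 i ⟨by omega, by omega⟩
    rw [hset, ih hS'.succ, h.setLIntegral_succ hS' (measurable_avoidance hA ℓ), inter_comm,
      ← setLIntegral_indicator ((h.measurable n) hA.compl)]
    rfl

theorem map_eq (h : IsMarkovChain κ μ P Z) (hμ : IsStationaryMeasure κ μ) (n : ℕ) :
    P.map (Z n) = μ := by
  induction n with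
  | zero => exact h.initial
  | succ n ih =>
    ext A hA
    have h1 := h.measure_past_inter (isPastEvent_univ n) hA
    rw [univ_inter, Measure.restrict_univ,
      ← lintegral_map (κ.measurable_coe hA) (h.measurable n), ih, hμ A hA] at h1
    rwa [Measure.map_apply (h.measurable _) hA]

theorem measure_inter_avoid (h : IsMarkovChain κ μ P Z) {A : Set M} (hA : MeasurableSet A)
    (s ℓ : ℕ) : P {w | Z 0 w ∈ A ∧ ∀ i ∈ Finset.Ico s (s + ℓ), Z i w ∉ A} =
      ∫⁻ x in A, (transfer κ)^[s] (avoidance κ A ℓ) x ∂μ := by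
  have hS : IsPastEvent Z 0 (Z 0 ⁻¹' A) := isPastEvent_preimage 0 hA
  have h1 := h.measure_past_avoid hA ℓ (hS.of_le (Nat.zero_le s))
  have h2 := h.setLIntegral_add hS (measurable_avoidance (κ := κ) hA ℓ) s
  rw [Nat.zero_add] at h2
  rw [← h.initial, setLIntegral_map hA
    (measurable_iterate_transfer (measurable_avoidance hA ℓ) s) (h.measurable 0), ← h2, ← h1]
  rfl

theorem measure_avoid (h : IsMarkovChain κ μ P Z) (hμ : IsStationaryMeasure κ μ)
    {A : Set M} (hA : MeasurableSet A) (s ℓ : ℕ) :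
    P {w | ∀ i ∈ Finset.Ico s (s + ℓ), Z i w ∉ A} = ∫⁻ x, avoidance κ A ℓ x ∂μ := by
  have h1 := h.measure_past_avoid hA ℓ (isPastEvent_univ s)
  rw [univ_inter, Measure.restrict_univ] at h1
  rw [h1, ← h.map_eq hμ s, lintegral_map (measurable_avoidance hA ℓ) (h.measurable s)]

theorem measure_mem (h : IsMarkovChain κ μ P Z) {A : Set M} (hA : MeasurableSet A) :
    P {w | Z 0 w ∈ A} = μ A := by
  rw [← h.initial, Measure.map_apply (h.measurable 0) hA]
  rfl

/-- Only the last transition is estimated, conditionally on the past up to time j - 1, so the bound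
is uniform in j. -/
theorem measure_inter_le (h : IsMarkovChain κ μ P Z) (hμ : IsStationaryMeasure κ μ)
    {A : Set M} (hA : MeasurableSet A) {c : ℝ≥0∞} (hc : ∀ᵐ x ∂μ, κ x A ≤ c) {j : ℕ}
    (hj : 1 ≤ j) : P {w | Z 0 w ∈ A ∧ Z j w ∈ A} ≤ c * μ A := by
  obtain ⟨n, rfl⟩ : ∃ n, j = n + 1 := ⟨j - 1, by omega⟩
  have hS : IsPastEvent Z n (Z 0 ⁻¹' A) := (isPastEvent_preimage 0 hA).of_le (Nat.zero_le n)
  have hc' : ∀ᵐ w ∂P, κ (Z n w) A ≤ c := by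
    rw [← h.map_eq hμ n] at hc
    exact ae_of_ae_map (h.measurable n).aemeasurable hc
  calc _ = ∫⁻ w in Z 0 ⁻¹' A, κ (Z n w) A ∂P := h.measure_past_inter hS hA
    _ ≤ ∫⁻ _ in Z 0 ⁻¹' A, c ∂P := lintegral_mono_ae (ae_restrict_of_ae hc')
    _ = c * μ A := by
      rw [setLIntegral_const, ← h.measure_mem hA]; rfl

/-- A stationary Markov chain whose transition operator contracts oscillations exponentially fast,
and whose transition probabilities are dominated by the stationary measure, has exponentially mixing
exceedances. -/
theorem hasMixingExceedances (h : IsMarkovChain κ μ P Z) (hμ : IsStationaryMeasure κ μ)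
    [IsMarkovKernel κ] [IsProbabilityMeasure μ] {φ : M → EReal} (hφ : Measurable φ)
    {C ρ : ℝ≥0} {N : ℕ} (hN : 0 < N) (hρ : ρ < 1)
    (hC : ∀ A, MeasurableSet A → ∀ᵐ x ∂μ, κ x A ≤ C * μ A)
    (hosc : ∀ g : M → ℝ≥0∞, Measurable g → (∀ x, g x ≤ 1) → ∀ s, ∃ a : ℝ≥0∞,
      ∀ᵐ x ∂μ, a ≤ (transfer κ)^[s] g x ∧ (transfer κ)^[s] g x ≤ a + (ρ : ℝ≥0∞) ^ (s / N)) :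
    HasMixingExceedances P (fun n w => φ (Z n w)) C ρ N := by
  have hP := h.prob
  have hA : ∀ u : ℝ, MeasurableSet {x | (u : EReal) < φ x} := fun u =>
    measurableSet_lt measurable_const hφ
  have hE : ∀ (u : ℝ) (ℓ s : ℕ),
      P {w | (u : EReal) < φ (Z 0 w) ∧ blockMax (fun n w => φ (Z n w)) s ℓ w ≤ u} =
        ∫⁻ x in {x | (u : EReal) < φ x},
          (transfer κ)^[s] (avoidance κ {x | (u : EReal) < φ x} ℓ) x ∂μ := by
    intro u ℓ s
    rw [← h.measure_inter_avoid (hA u) s ℓ]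
    simp only [blockMax_le_iff, mem_ofPred_eq, not_lt]
  have hG : ∀ (u : ℝ) (ℓ : ℕ), P {w | partialMax (fun n w => φ (Z n w)) ℓ w ≤ u} =
      ∫⁻ x, avoidance κ {x | (u : EReal) < φ x} ℓ x ∂μ := by
    intro u ℓ
    rw [← h.measure_avoid hμ (hA u) 0 ℓ]
    simp only [partialMax_le_iff, mem_ofPred_eq, not_lt, Finset.mem_Ico, zero_add, Nat.zero_le,
      true_and]
  have hp : ∀ u : ℝ, P {w | (u : EReal) < φ (Z 0 w)} = μ {x | (u : EReal) < φ x} := fun u =>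
    h.measure_mem (hA u)
  refine ⟨hP, C.2, ρ.2, hρ, hN, fun u ℓ s => ?_, fun u j hj => ?_, fun u ℓ => ?_⟩
  -- Both the joint probability and the product of probabilities lie between aμ(A) and (a + δ)μ(A),
  -- hence differ by at most δμ(A).
  · obtain ⟨a, ha⟩ := hosc _ (measurable_avoidance (κ := κ) (hA u) ℓ)
      (avoidance_le_one (κ := κ) _ ℓ) s
    set A := {x | (u : EReal) < φ x}
    set g := avoidance κ A ℓ
    set δ : ℝ≥0∞ := (ρ : ℝ≥0∞) ^ (s / N) with hδ
    have hμg : ∫⁻ x, g x ∂μ = ∫⁻ x, (transfer κ)^[s] g x ∂μ :=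
      (hμ.lintegral_iterate_transfer (measurable_avoidance (hA u) ℓ) s).symm
    have g1 : a ≤ ∫⁻ x, g x ∂μ := by
      rw [hμg]
      calc a = ∫⁻ _, a ∂μ := by simp
        _ ≤ _ := lintegral_mono_ae (ha.mono fun x hx => hx.1)
    have g2 : ∫⁻ x, g x ∂μ ≤ a + δ := by
      rw [hμg]
      calc _ ≤ ∫⁻ _, (a + δ) ∂μ := lintegral_mono_ae (ha.mono fun x hx => hx.2)
        _ = a + δ := by simp
    have g3 : a * μ A ≤ ∫⁻ x in A, (transfer κ)^[s] g x ∂μ := by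
      rw [← setLIntegral_const]
      exact lintegral_mono_ae (ae_restrict_of_ae (ha.mono fun x hx => hx.1))
    have g4 : ∫⁻ x in A, (transfer κ)^[s] g x ∂μ ≤ (a + δ) * μ A := by
      rw [← setLIntegral_const]
      exact lintegral_mono_ae (ae_restrict_of_ae (ha.mono fun x hx => hx.2))
    rw [← hE u ℓ s] at g3 g4
    rw [← hG u ℓ] at g1 g2
    have hδt : δ ≠ ⊤ := ENNReal.pow_ne_top ENNReal.coe_ne_top
    have hat : a ≠ ⊤ := (g1.trans_lt (measure_lt_top _ _)).ne
    have hadt : a + δ ≠ ⊤ := ENNReal.add_ne_top.2 ⟨hat, hδt⟩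
    have k1 := ENNReal.toReal_mono (measure_ne_top _ _) g1
    have k2 := ENNReal.toReal_mono hadt g2
    have k3 := ENNReal.toReal_mono (measure_ne_top _ _) g3
    have k4 := ENNReal.toReal_mono (ENNReal.mul_ne_top hadt (measure_ne_top _ _)) g4
    rw [ENNReal.toReal_add hat hδt] at k2
    rw [ENNReal.toReal_mul] at k3 k4
    rw [ENNReal.toReal_add hat hδt] at k4
    have hδr : δ.toReal = (ρ : ℝ) ^ (s / N) := by simp [hδ]
    simp only [measureReal_def]
    rw [hp u, ← hδr]
    have hpn : 0 ≤ (μ A).toReal := ENNReal.toReal_nonneg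
    rw [abs_le]
    constructor <;> nlinarith
  · have h1 := h.measure_inter_le hμ (hA u) (hC _ (hA u)) hj
    have h2 := ENNReal.toReal_mono
      (ENNReal.mul_ne_top (ENNReal.mul_ne_top ENNReal.coe_ne_top (measure_ne_top _ _))
        (measure_ne_top _ _)) h1
    simp only [measureReal_def]
    rw [hp u]
    refine h2.trans_eq ?_
    simp [ENNReal.toReal_mul]
    ring
  -- Stationarity moves the window of length ℓ from time 0 to time 1; the event is then split
  -- according to the state at time 0.
  · have h1 : P {w | partialMax (fun n w => φ (Z n w)) ℓ w ≤ u} =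
        P {w | partialMax (fun n w => φ (Z n w)) (ℓ + 1) w ≤ u} +
          P {w | (u : EReal) < φ (Z 0 w) ∧ blockMax (fun n w => φ (Z n w)) 1 ℓ w ≤ u} := by
      rw [hG, hG, hE, ← hμ.lintegral_transfer (measurable_avoidance (hA u) ℓ),
        ← lintegral_add_compl _ (hA u), add_comm]
      congr 1
      exact (lintegral_indicator (hA u).compl _).symm
    simp only [measureReal_def]
    rw [h1, ENNReal.toReal_add (measure_ne_top _ _) (measure_ne_top _ _)]

end IsMarkovChain

end Chain

/-! ### Reachability along the dense orbit and Doeblin's condition. -/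

/-- A nontrivial connected metric space has no isolated points, so deleting the first K orbit points
preserves density; a one-point space is treated apart. -/
theorem exists_orbit_dist_lt {M : Type*} [MetricSpace M] [ConnectedSpace M] {f : M → M} {x₀ : M}
    (hdense : DenseRange fun n : ℕ => f^[n] x₀) (K : ℕ) (y : M) {δ : ℝ} (hδ : 0 < δ) :
    ∃ k, K ≤ k ∧ dist (f^[k] x₀) y < δ := by
  rcases subsingleton_or_nontrivial M with hM | hM
  · exact ⟨K, le_rfl, by rwa [Subsingleton.elim (f^[K] x₀) y, dist_self]⟩
  · have hfin : ((fun n : ℕ => f^[n] x₀) '' Iio K).Finite := (finite_Iio K).image _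
    obtain ⟨z, ⟨⟨k, rfl⟩, hk⟩, hz⟩ := (hdense.sdiff_finite hfin).exists_dist_lt y hδ
    refine ⟨k, ?_, by rwa [dist_comm]⟩
    by_contra hlt
    exact hk ⟨k, not_le.1 hlt, rfl⟩

/-- Transition probabilities which are, for almost every `x`, dominated by `qup m` and minorised by
`qlow m` on a ball of radius `4 r` about `f x`. -/
structure IsNoisyKernel {M : Type*} [MetricSpace M] [MeasurableSpace M] (κ : Kernel M M)
    (m : Measure M) (f : M → M) (r : ℝ) (qlow qup : ℝ≥0) : Prop where
  radius_pos : 0 < r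
  low_pos : 0 < qlow
  upper : ∀ᵐ x ∂m, ∀ A, MeasurableSet A → κ x A ≤ qup * m A
  lower : ∀ᵐ x ∂m, ∀ y, dist (f x) y < 3 * r →
    (qlow : ℝ≥0∞) • m.restrict (Metric.ball y r) ≤ κ x

/-- Starting from `m` restricted to the `r`-ball about `x`, the distribution of the chain after `n`
steps dominates a multiple of `m` restricted to the `r`-ball about `y`. -/
def Reach {M : Type*} [MetricSpace M] [MeasurableSpace M] (κ : Kernel M M) (m : Measure M) (r : ℝ)
    (n : ℕ) (x y : M) : Prop :=
  ∃ c : ℝ≥0∞, c ≠ 0 ∧ ∀ g : M → ℝ≥0∞, Measurable g →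
    c * ∫⁻ z in Metric.ball y r, g z ∂m ≤ ∫⁻ z in Metric.ball x r, (transfer κ)^[n] g z ∂m

/-- Two points from which a common point can be reached in the same number of steps. -/
def Coalesce {M : Type*} [MetricSpace M] [MeasurableSpace M] (κ : Kernel M M) (m : Measure M)
    (r : ℝ) (x y : M) : Prop :=
  ∃ n z, Reach κ m r n x z ∧ Reach κ m r n y z

section Reach

variable {M : Type*} [MetricSpace M] [MeasurableSpace M] {κ : Kernel M M}
  {m : Measure M} {f : M → M} {r : ℝ} {qlow qup : ℝ≥0}

theorem Reach.refl (x : M) : Reach κ m r 0 x x := ⟨1, one_ne_zero, fun g _ => by simp⟩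

theorem Reach.trans {n k : ℕ} {x y z : M} (h : Reach κ m r n x y) (h' : Reach κ m r k y z) :
    Reach κ m r (n + k) x z := by
  obtain ⟨c, hc, H⟩ := h
  obtain ⟨c', hc', H'⟩ := h'
  refine ⟨c * c', mul_ne_zero hc hc', fun g hg => ?_⟩
  rw [mul_assoc, Function.iterate_add_apply]
  exact (mul_le_mul_right (H' g hg) c).trans (H _ (measurable_iterate_transfer hg k))

theorem Coalesce.symm {x y : M} (h : Coalesce κ m r x y) : Coalesce κ m r y x :=
  let ⟨n, z, h1, h2⟩ := h
  ⟨n, z, h2, h1⟩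

variable [ConnectedSpace M] [CompactSpace M] [BorelSpace M] [m.IsOpenPosMeasure] {Y : Set M} {x₀ : M}

/-- A noisy kernel around a map with a dense orbit along which it is continuous. -/
structure IsTransitiveNoise {M : Type*} [MetricSpace M] [MeasurableSpace M] (κ : Kernel M M)
    (m : Measure M) (f : M → M) (Y : Set M) (x₀ : M) (r : ℝ) (qlow qup : ℝ≥0) : Prop
    extends IsNoisyKernel κ m f r qlow qup where
  ae_mem : ∀ᵐ x ∂m, x ∈ Y
  cont : ContinuousOn f Y
  dense : DenseRange fun n : ℕ => f^[n] x₀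
  orbit : ∀ n : ℕ, f^[n] x₀ ∈ Y

namespace IsTransitiveNoise

omit [ConnectedSpace M] [CompactSpace M] in
-- By continuity along Y, almost every point of a small open neighbourhood U of p = f^[k] x₀ has its
-- image within r of f(p), hence within 3r of y. The tolerance 2r for y, rather than r, is what
-- later lets two nearby targets be hit at the same time.
theorem reach_one (h : IsTransitiveNoise κ m f Y x₀ r qlow qup) {k : ℕ} {x y : M}
    (hx : dist (f^[k] x₀) x < r) (hy : dist (f^[k + 1] x₀) y < 2 * r) :
    Reach κ m r 1 x y := by
  set p := f^[k] x₀ with hp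
  rw [Function.iterate_succ_apply', ← hp] at hy
  have hcont : {x' | dist (f x') (f p) < r} ∈ 𝓝[Y] p :=
    h.cont p (h.orbit k) (Metric.ball_mem_nhds _ h.radius_pos)
  obtain ⟨U, hU, hpU, hUY⟩ := mem_nhdsWithin.1 hcont
  have hV : IsOpen (U ∩ Metric.ball x r) := hU.inter Metric.isOpen_ball
  have hVpos : 0 < m (U ∩ Metric.ball x r) := hV.measure_pos m ⟨p, hpU, hx⟩
  refine ⟨qlow * m (U ∩ Metric.ball x r),
    mul_ne_zero (by simpa using h.low_pos.ne') hVpos.ne', fun g _ => ?_⟩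
  calc _ = ∫⁻ _ in U ∩ Metric.ball x r, (qlow * ∫⁻ z in Metric.ball y r, g z ∂m) ∂m := by
        rw [setLIntegral_const]; ring
    _ ≤ ∫⁻ z in U ∩ Metric.ball x r, transfer κ g z ∂m := by
        refine setLIntegral_mono_ae' hV.measurableSet ?_
        filter_upwards [h.ae_mem, h.lower] with x' hx' hlow hxV
        have hd : dist (f x') (f p) < r := hUY ⟨hxV.1, hx'⟩
        have := hlow y (by linarith [dist_triangle (f x') (f p) y])
        rw [← smul_eq_mul, ← lintegral_smul_measure]
        exact lintegral_mono' this le_rfl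
    _ ≤ _ := lintegral_mono_set inter_subset_right

omit [ConnectedSpace M] [CompactSpace M] in
theorem reach_orbit (h : IsTransitiveNoise κ m f Y x₀ r qlow qup) {k : ℕ} {x : M}
    (hx : dist (f^[k] x₀) x < r) (n : ℕ) {y : M} (hy : dist (f^[k + n + 1] x₀) y < r) :
    Reach κ m r (n + 1) x y := by
  have hr := h.radius_pos
  induction n generalizing y with
  | zero => exact h.reach_one hx (by rw [Nat.add_zero] at hy; linarith)
  | succ n ih =>
    refine (ih (y := f^[k + n + 1] x₀) (by simpa using hr)).trans
      (h.reach_one (k := k + n + 1) (by simpa using hr) ?_)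
    rw [show k + n + 1 + 1 = k + (n + 1) + 1 by ring]
    linarith

omit [CompactSpace M] in
theorem exists_reach (h : IsTransitiveNoise κ m f Y x₀ r qlow qup) (x y : M) :
    ∃ n, Reach κ m r n x y := by
  obtain ⟨k, -, hk⟩ := exists_orbit_dist_lt h.dense 0 x h.radius_pos
  obtain ⟨l, hl, hly⟩ := exists_orbit_dist_lt h.dense (k + 1) y h.radius_pos
  exact ⟨_, h.reach_orbit hk (l - k - 1)
    (by rwa [show k + (l - k - 1) + 1 = l by omega])⟩

omit [CompactSpace M] in
theorem exists_reach_of_steps (h : IsTransitiveNoise κ m f Y x₀ r qlow qup) (x : M) (n : ℕ) :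
    ∃ y, Reach κ m r n x y := by
  obtain ⟨k, -, hk⟩ := exists_orbit_dist_lt h.dense 0 x h.radius_pos
  cases n with
  | zero => exact ⟨x, Reach.refl x⟩
  | succ n => exact ⟨f^[k + n + 1] x₀, h.reach_orbit hk n (by rw [dist_self]; exact h.radius_pos)⟩

omit [CompactSpace M] in
-- With return paths a → y and b → y, the routes x → a → y → b → y and z → b → y → a → y use the
-- same segment lengths in a different order.
theorem coalesce_trans (h : IsTransitiveNoise κ m f Y x₀ r qlow qup) {x y z : M}
    (hxy : Coalesce κ m r x y) (hyz : Coalesce κ m r y z) : Coalesce κ m r x z := by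
  obtain ⟨n, a, hxa, hya⟩ := hxy
  obtain ⟨k, b, hyb, hzb⟩ := hyz
  obtain ⟨s, hs⟩ := h.exists_reach a y
  obtain ⟨t, ht⟩ := h.exists_reach b y
  refine ⟨(n + s) + (k + t), y, (hxa.trans hs).trans (hyb.trans ht), ?_⟩
  rw [add_comm]
  exact (hzb.trans ht).trans (hya.trans hs)

omit [CompactSpace M] in
-- An orbit point w whose image is near x reaches both x and y in one step. The loops x → w → y → w
-- and y → w → x → w then have equal length a + 1 + b.
theorem coalesce_of_dist_lt (h : IsTransitiveNoise κ m f Y x₀ r qlow qup) {x y : M}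
    (hxy : dist x y < r) : Coalesce κ m r x y := by
  obtain ⟨l, hl, hlx⟩ := exists_orbit_dist_lt h.dense 1 x h.radius_pos
  obtain ⟨k, rfl⟩ : ∃ k, l = k + 1 := ⟨l - 1, by omega⟩
  have hr := h.radius_pos
  have hwx : Reach κ m r 1 (f^[k] x₀) x := h.reach_one (k := k) (by rwa [dist_self]) (by linarith)
  have hwy : Reach κ m r 1 (f^[k] x₀) y :=
    h.reach_one (k := k) (by rwa [dist_self]) (by linarith [dist_triangle (f^[k + 1] x₀) x y])
  obtain ⟨a, ha⟩ := h.exists_reach x (f^[k] x₀)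
  obtain ⟨b, hb⟩ := h.exists_reach y (f^[k] x₀)
  refine ⟨a + (1 + b), _, ha.trans (hwy.trans hb), ?_⟩
  rw [show a + (1 + b) = b + (1 + a) by ring]
  exact hb.trans (hwx.trans ha)

omit [CompactSpace M] in
theorem coalesce (h : IsTransitiveNoise κ m f Y x₀ r qlow qup) (x y : M) :
    Coalesce κ m r x y := by
  have hclopen : IsClopen {y | Coalesce κ m r x y} := by
    refine ⟨⟨Metric.isOpen_iff.2 fun y hy => ⟨r, h.radius_pos, fun z hz hxz => hy ?_⟩⟩,
      Metric.isOpen_iff.2 fun y hy => ⟨r, h.radius_pos, fun z hz => ?_⟩⟩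
    · exact h.coalesce_trans hxz (h.coalesce_of_dist_lt hz)
    · exact h.coalesce_trans hy (h.coalesce_of_dist_lt hz).symm
  have huniv := hclopen.eq_univ ⟨x, 0, x, Reach.refl x, Reach.refl x⟩
  exact huniv.ge (mem_univ y)

omit [CompactSpace M] in
-- The new point is first moved n steps to some w, to synchronise it with the others; then w and
-- their common target coalesce.
theorem exists_common_reach (h : IsTransitiveNoise κ m f Y x₀ r qlow qup) (S : Finset M) :
    ∃ n y, ∀ z ∈ S, Reach κ m r n z y := by
  classical
  induction S using Finset.induction_on with
  | empty => exact ⟨0, x₀, by simp⟩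
  | insert z S _ ih =>
    obtain ⟨n, y, hy⟩ := ih
    obtain ⟨w, hw⟩ := h.exists_reach_of_steps z n
    obtain ⟨k, v, hyv, hwv⟩ := h.coalesce y w
    refine ⟨n + k, v, fun z' hz' => ?_⟩
    rcases Finset.mem_insert.1 hz' with rfl | hz'
    · exact hw.trans hwv
    · exact (hy z' hz').trans hyv

omit [MeasurableSpace M] [ConnectedSpace M] [BorelSpace M] in
theorem exists_finite_net (hr : 0 < r) : ∃ S : Finset M, ∀ x : M, ∃ z ∈ S, dist x z < r := by
  obtain ⟨S, -, hfin, hS⟩ := finite_cover_balls_of_compact (isCompact_univ (X := M)) hr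
  refine ⟨hfin.toFinset, fun x => ?_⟩
  obtain ⟨z, hz, hxz⟩ := mem_iUnion₂.1 (hS (mem_univ x))
  exact ⟨z, hfin.mem_toFinset.2 hz, hxz⟩

/-- Doeblin's condition: the `N`-step transition probabilities have a common minorant. -/
theorem exists_minorant (h : IsTransitiveNoise κ m f Y x₀ r qlow qup) :
    ∃ (N : ℕ) (y : M) (c : ℝ≥0∞), 0 < N ∧ c ≠ 0 ∧ ∀ᵐ x ∂m, ∀ g : M → ℝ≥0∞, Measurable g →
      c * ∫⁻ z in Metric.ball y r, g z ∂m ≤ (transfer κ)^[N] g x := by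
  obtain ⟨S, hS⟩ := exists_finite_net (M := M) h.radius_pos
  obtain ⟨n, y, hy⟩ := h.exists_common_reach S
  choose! c hc H using hy
  refine ⟨n + 1, y, qlow * S.inf c, n.succ_pos, mul_ne_zero (by simpa using h.low_pos.ne') ?_, ?_⟩
  · rw [← pos_iff_ne_zero, Finset.lt_inf_iff (by simp)]
    exact fun z hz => pos_iff_ne_zero.2 (hc z hz)
  filter_upwards [h.lower] with x hx g hg
  -- The first step charges the ball about a net point near f(x); the remaining n steps carry that
  -- mass to y. This explains N = n + 1.
  obtain ⟨z, hz, hxz⟩ := hS (f x)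
  have hr := h.radius_pos
  rw [Function.iterate_succ_apply', mul_assoc]
  calc (qlow : ℝ≥0∞) * (S.inf c * ∫⁻ z in Metric.ball y r, g z ∂m)
      ≤ qlow * (c z * ∫⁻ z in Metric.ball y r, g z ∂m) := by
        gcongr; exact Finset.inf_le hz
    _ ≤ qlow * ∫⁻ z in Metric.ball z r, (transfer κ)^[n] g z ∂m := by
        gcongr; exact H z hz g hg
    _ ≤ _ := by
        rw [← smul_eq_mul, ← lintegral_smul_measure]
        exact lintegral_mono' (hx z (by linarith)) le_rfl

/-- Stationarity writes μ(A) as the μ-integral of an (N + n)-step transition probability. The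
minorant followed by a path from y to z bounds it below by a multiple of m(A ∩ B(z, r)), and a
finite net sums these bounds. -/
theorem exists_measure_le (h : IsTransitiveNoise κ m f Y x₀ r qlow qup) {μ : Measure M}
    [IsProbabilityMeasure μ] (hμ : IsStationaryMeasure κ μ) (hμm : μ ≪ m) :
    ∃ C : ℝ≥0, ∀ A, MeasurableSet A → m A ≤ C * μ A := by
  obtain ⟨N, y, c, -, hc, hdoeb⟩ := h.exists_minorant
  obtain ⟨S, hS⟩ := exists_finite_net (M := M) h.radius_pos
  have key : ∀ z, ∃ C : ℝ≥0, ∀ A, MeasurableSet A → m (A ∩ Metric.ball z r) ≤ C * μ A := by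
    intro z
    obtain ⟨n, c', hc', H⟩ := h.exists_reach y z
    -- The constants may be infinite; truncation at 1 makes their product invertible.
    have hpos : min (c * c') 1 ≠ 0 := by simp [hc, hc']
    have hfin : min (c * c') 1 ≠ ⊤ := by simp
    refine ⟨((min (c * c') 1)⁻¹).toNNReal, fun A hA => ?_⟩
    rw [ENNReal.coe_toNNReal (ENNReal.inv_ne_top.2 hpos),
      ← ENNReal.mul_le_iff_le_inv hpos hfin]
    have hg : Measurable (A.indicator (1 : M → ℝ≥0∞)) := measurable_one.indicator hA
    calc min (c * c') 1 * m (A ∩ Metric.ball z r) ≤ (c * c') * m (A ∩ Metric.ball z r) := by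
          gcongr; exact min_le_left _ _
      _ = c * (c' * ∫⁻ x in Metric.ball z r, A.indicator 1 x ∂m) := by
          rw [lintegral_indicator_one hA, Measure.restrict_apply hA, mul_assoc]
      _ ≤ c * ∫⁻ x in Metric.ball y r, (transfer κ)^[n] (A.indicator 1) x ∂m := by
          gcongr; exact H _ hg
      _ = ∫⁻ _, (c * ∫⁻ x in Metric.ball y r, (transfer κ)^[n] (A.indicator 1) x ∂m) ∂μ := by
          simp
      _ ≤ ∫⁻ x, (transfer κ)^[N] ((transfer κ)^[n] (A.indicator 1)) x ∂μ :=
          lintegral_mono_ae (by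
            filter_upwards [hμm.ae_le hdoeb] with x hx
            exact hx _ (measurable_iterate_transfer hg n))
      _ = μ A := by
          rw [hμ.lintegral_iterate_transfer (measurable_iterate_transfer hg n),
            hμ.lintegral_iterate_transfer hg, lintegral_indicator_one hA]
  choose C hC using key
  refine ⟨∑ z ∈ S, C z, fun A hA => ?_⟩
  calc m A ≤ m (⋃ z ∈ S, A ∩ Metric.ball z r) := by
        refine measure_mono fun x hx => ?_
        obtain ⟨z, hz, hxz⟩ := hS x
        exact mem_iUnion₂.2 ⟨z, hz, hx, hxz⟩
    _ ≤ ∑ z ∈ S, m (A ∩ Metric.ball z r) := measure_biUnion_finset_le _ _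
    _ ≤ ∑ z ∈ S, C z * μ A := Finset.sum_le_sum fun z _ => hC z A hA
    _ = _ := by rw [← Finset.sum_mul]; push_cast; rfl

end IsTransitiveNoise

end Reach

/-! ### Contraction of oscillation under a minorisation. -/

section Contraction

variable {M : Type*} [MeasurableSpace M] {κ : Kernel M M} [IsMarkovKernel κ] {μ ν : Measure M}
  {N : ℕ} {ε ρ : ℝ≥0∞}

/-- Write g = a + k with 0 ≤ k ≤ δ. Minorising the N-step averages of both k and δ - k confines the
average of k between ∫ k dν and ∫ k dν + (1 - ε)δ. -/
theorem IsStationaryMeasure.oscillation_step (hμ : IsStationaryMeasure κ μ)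
    (hν : ν univ = ε) (hρ : ρ + ε = 1)
    (hmin : ∀ᵐ x ∂μ, ∀ g : M → ℝ≥0∞, Measurable g → ∫⁻ z, g z ∂ν ≤ (transfer κ)^[N] g x)
    {g : M → ℝ≥0∞} (hg : Measurable g) {a δ : ℝ≥0∞} (hδ : δ ≠ ⊤)
    (hosc : ∀ᵐ x ∂μ, a ≤ g x ∧ g x ≤ a + δ) :
    ∃ b, ∀ᵐ x ∂μ, b ≤ (transfer κ)^[N] g x ∧ (transfer κ)^[N] g x ≤ b + ρ * δ := by
  have hε : ε ≠ ⊤ := fun h => by simp [h] at hρ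
  -- Truncation makes k ≤ δ hold everywhere, not just almost everywhere, so that k + (δ - k) = δ
  -- identically.
  set k : M → ℝ≥0∞ := fun x => min (g x - a) δ with hk
  have hkm : Measurable k := (hg.sub_const a).min measurable_const
  have hkδ : ∀ x, k x ≤ δ := fun x => min_le_right _ _
  have hgk : g =ᵐ[μ] (fun _ => a) + k := by
    filter_upwards [hosc] with x hx
    have : g x - a ≤ δ := tsub_le_iff_left.2 hx.2
    simp [hk, min_eq_left this, add_tsub_cancel_of_le hx.1]
  refine ⟨a + ∫⁻ z, k z ∂ν, ?_⟩
  filter_upwards [hμ.iterate_transfer_congr hgk N, hmin] with x hx hxmin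
  rw [hx, iterate_transfer_add measurable_const, iterate_transfer_const, Pi.add_apply]
  refine ⟨by gcongr; exact hxmin k hkm, ?_⟩
  rw [add_assoc]
  gcongr
  have hsum : k + (fun x => δ - k x) = fun _ => δ := by
    funext x
    exact add_tsub_cancel_of_le (hkδ x)
  have h1 : (transfer κ)^[N] k x + (transfer κ)^[N] (fun x => δ - k x) x = δ := by
    have := congrFun (iterate_transfer_add (κ := κ) (h := fun x => δ - k x) hkm N) x
    rw [hsum, iterate_transfer_const] at this
    exact this.symm
  have h2 : ∫⁻ z, k z ∂ν + ∫⁻ z, (δ - k z) ∂ν = δ * ε := by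
    rw [← lintegral_add_left hkm, ← hν, ← lintegral_const]
    exact lintegral_congr fun x => add_tsub_cancel_of_le (hkδ x)
  have h3 := hxmin (fun x => δ - k x) (measurable_const.sub hkm)
  refine (ENNReal.add_le_add_iff_right (ENNReal.mul_ne_top hδ hε)).1 ?_
  calc (transfer κ)^[N] k x + δ * ε
      = ∫⁻ z, k z ∂ν + ((transfer κ)^[N] k x + ∫⁻ z, (δ - k z) ∂ν) := by rw [← h2]; ring
    _ ≤ ∫⁻ z, k z ∂ν + ((transfer κ)^[N] k x + (transfer κ)^[N] (fun x => δ - k x) x) := by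
        gcongr
    _ = ∫⁻ z, k z ∂ν + (ρ + ε) * δ := by rw [h1, hρ, one_mul]
    _ = _ := by ring

theorem IsStationaryMeasure.oscillation_iterate (hμ : IsStationaryMeasure κ μ)
    (hν : ν univ = ε) (hρ : ρ + ε = 1)
    (hmin : ∀ᵐ x ∂μ, ∀ g : M → ℝ≥0∞, Measurable g → ∫⁻ z, g z ∂ν ≤ (transfer κ)^[N] g x)
    {g : M → ℝ≥0∞} (hg : Measurable g) (hg1 : ∀ x, g x ≤ 1) (s : ℕ) :
    ∃ a, ∀ᵐ x ∂μ, a ≤ (transfer κ)^[s] g x ∧ (transfer κ)^[s] g x ≤ a + ρ ^ (s / N) := by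
  have hρt : ρ ≠ ⊤ := fun h => by simp [h] at hρ
  have key : ∀ k : ℕ, ∃ a, ∀ᵐ x ∂μ, a ≤ (transfer κ)^[N * k + s % N] g x ∧
      (transfer κ)^[N * k + s % N] g x ≤ a + ρ ^ k := by
    intro k
    induction k with
    | zero =>
      refine ⟨0, Eventually.of_forall fun x => ⟨zero_le, ?_⟩⟩
      have := iterate_transfer_mono (κ := κ) (h := fun _ => 1) hg1 (N * 0 + s % N) x
      rw [iterate_transfer_const] at this
      simpa using this
    -- The s % N leftover steps were put in the base case, where only g ≤ 1 is needed; each further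
    -- block of N steps gains a factor ρ.
    | succ k ih =>
      obtain ⟨a, ha⟩ := ih
      obtain ⟨b, hb⟩ := hμ.oscillation_step hν hρ hmin (measurable_iterate_transfer hg _)
        (ENNReal.pow_ne_top hρt) ha
      refine ⟨b, ?_⟩
      rw [show N * (k + 1) + s % N = N + (N * k + s % N) by ring, Function.iterate_add_apply,
        pow_succ']
      exact hb
  obtain ⟨a, ha⟩ := key (s / N)
  rw [Nat.div_add_mod] at ha
  exact ⟨a, ha⟩

end Contraction

/-- A stationary Markov chain driven by a noisy kernel around a transitive map has exponential
extreme value statistics. -/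
theorem IsTransitiveNoise.exponentialExtremes {M Ω : Type*} [MetricSpace M] [MeasurableSpace M]
    [ConnectedSpace M] [CompactSpace M] [BorelSpace M] [MeasurableSpace Ω] {κ : Kernel M M}
    [IsMarkovKernel κ] {m μ : Measure M} [m.IsOpenPosMeasure] [IsProbabilityMeasure m]
    [IsProbabilityMeasure μ] {f : M → M} {Y : Set M} {x₀ : M} {r : ℝ} {qlow qup : ℝ≥0}
    (h : IsTransitiveNoise κ m f Y x₀ r qlow qup) (hμ : IsStationaryMeasure κ μ)
    (hκm : ∀ᵐ x ∂μ, κ x ≪ m) {d : ℕ} {φ : M → EReal} {ζ : M} (hφ : IsRegularObservable d μ φ ζ)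
    {P : Measure Ω} {Z : ℕ → Ω → M} (hZ : IsMarkovChain κ μ P Z) :
    ExponentialExtremes P (fun n w => φ (Z n w)) := by
  -- Stationarity averages the absolute continuity of the transitions, so m-almost sure estimates
  -- become μ-almost sure.
  have hμm : μ ≪ m := by
    refine Measure.AbsolutelyContinuous.mk fun A hA hmA => ?_
    rw [← hμ A hA, lintegral_eq_zero_iff (κ.measurable_coe hA)]
    exact hκm.mono fun x hx => hx hmA
  obtain ⟨C, hC⟩ := h.exists_measure_le hμ hμm
  obtain ⟨N, y, c, hN, hc, hdoeb⟩ := h.exists_minorant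
  have hball : 0 < m (Metric.ball y r) := Metric.measure_ball_pos m y h.radius_pos
  set ν : Measure M := c • m.restrict (Metric.ball y r) with hν
  have hmin : ∀ᵐ x ∂μ, ∀ g : M → ℝ≥0∞, Measurable g →
      ∫⁻ z, g z ∂ν ≤ (transfer κ)^[N] g x := by
    filter_upwards [hμm.ae_le hdoeb] with x hx g hg
    rw [hν, lintegral_smul_measure]
    exact hx g hg
  have hε0 : ν univ ≠ 0 := by
    simp [hν, hc, hball.ne']
  have hε1 : ν univ ≤ 1 := by
    obtain ⟨x, hx⟩ := hmin.exists
    have := hx (fun _ => 1) measurable_const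
    rw [iterate_transfer_const] at this
    simpa using this
  have hρ : ((1 - ν univ).toNNReal : ℝ≥0∞) = 1 - ν univ :=
    ENNReal.coe_toNNReal (by simp)
  have hmix := hZ.hasMixingExceedances hμ hφ.measurable (C := qup * C)
    (ρ := (1 - ν univ).toNNReal) hN
    (by
      rw [← ENNReal.coe_lt_coe, hρ]
      exact ENNReal.sub_lt_self (by simp) (by simp) hε0)
    (fun A hA => by
      filter_upwards [hμm.ae_le h.upper] with x hx
      refine (hx A hA).trans ?_
      push_cast
      rw [mul_assoc]
      gcongr
      exact hC A hA)
    (fun g hg hg1 s => by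
      rw [hρ]
      exact hμ.oscillation_iterate rfl (tsub_add_cancel_of_le hε1) hmin hg hg1 s)
  refine hmix.exponentialExtremes fun τ hτ => ?_
  -- The superlevel set is open and nonempty, so it has positive m-measure, and m ≤ Cμ passes this
  -- on to μ.
  have hpos : ∀ᶠ u in 𝓝[<] (φ ζ), 0 < μ {x | u < φ x} := by
    filter_upwards [hφ.ball] with u hu
    obtain ⟨e, hes, het, heζ⟩ := hu
    have hopen : IsOpen {x | u < φ x} := het ▸ e.open_target
    have hne : ({x | u < φ x}).Nonempty := by
      rw [← het]
      exact ⟨e 0, e.map_source (by rw [hes]; simp)⟩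
    have h1 := hC _ hopen.measurableSet
    refine pos_iff_ne_zero.2 fun h0 => (hopen.measure_pos m hne).ne' ?_
    rw [h0, mul_zero] at h1
    exact le_zero_iff.1 h1
  obtain ⟨u, hu⟩ := exists_levels hφ.max hφ.ne_bot hpos hφ.continuous hτ
  refine ⟨u, ?_⟩
  unfold IsNormalizing
  simp only [measureReal_def]
  have hlaw : ∀ n, P {w | (u n : EReal) < φ (Z 0 w)} = μ {x | (u n : EReal) < φ x} := fun n =>
    hZ.measure_mem (measurableSet_lt measurable_const hφ.measurable)
  simpa only [hlaw, measureReal_def] using hu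

theorem IsNormalizedVolume.isOpenPosMeasure {d : ℕ} {M : Type*} [TopologicalSpace M]
    [ChartedSpace (EuclideanSpace ℝ (Fin d)) M] [MeasurableSpace M] [BorelSpace M] {m : Measure M}
    (h : IsNormalizedVolume d m) : m.IsOpenPosMeasure := by
  refine ⟨fun U hU ⟨x, hx⟩ h0 => ?_⟩
  set e := chartAt (EuclideanSpace ℝ (Fin d)) x
  obtain ⟨ρ, hρc, hρpos, hρ⟩ := h.density e (chart_mem_atlas _ x)
  have hV : IsOpen (U ∩ e.source) := hU.inter e.open_source
  have hint := hρ _ inter_subset_right hV.measurableSet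
  have himg : IsOpen (e '' (U ∩ e.source)) := e.isOpen_image_of_subset_source hV inter_subset_right
  have hsub : e '' (U ∩ e.source) ⊆ e.target := by
    rintro _ ⟨z, hz, rfl⟩
    exact e.map_source hz.2
  have hmeas : AEMeasurable (fun y => ENNReal.ofReal (ρ y))
      (volume.restrict (e '' (U ∩ e.source))) :=
    ((hρc.mono hsub).aemeasurable himg.measurableSet).ennreal_ofReal
  rw [measure_mono_null inter_subset_left h0, eq_comm, lintegral_eq_zero_iff' hmeas,
    Filter.EventuallyEq, ae_restrict_iff' himg.measurableSet] at hint
  have hpos : 0 < volume (e '' (U ∩ e.source)) :=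
    himg.measure_pos volume ⟨e x, x, ⟨hx, mem_chart_source _ x⟩, rfl⟩
  refine hpos.ne' (measure_mono_null (fun y hy => ?_) (ae_iff.1 hint))
  exact fun hy' => (ENNReal.ofReal_pos.2 (hρpos y (hsub hy))).ne' (hy' hy)

/-! ### Random orbits as a Markov chain. -/

section RandomMaps

variable {M X : Type*} [MeasurableSpace M] [MeasurableSpace X] {F : M → X → M}

theorem measurable_transition (hF : Measurable (Function.uncurry F)) (θ : Measure X)
    [IsProbabilityMeasure θ] : Measurable fun x => θ.map (F x) := by
  refine Measure.measurable_of_measurable_coe _ fun A hA => ?_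
  have : (fun x => θ.map (F x) A) = fun x => θ (Prod.mk x ⁻¹' (Function.uncurry F ⁻¹' A)) := by
    funext x
    exact Measure.map_apply (hF.comp measurable_prodMk_left) hA
  rw [this]
  exact measurable_measure_prodMk_left (hF hA)

theorem measurable_randomOrbit (hF : Measurable (Function.uncurry F)) (n : ℕ) :
    Measurable fun z : M × (ℕ → X) => randomOrbit F z.2 n z.1 := by
  induction n with
  | zero => exact measurable_fst
  | succ n ih =>
    exact hF.comp (ih.prodMk ((measurable_pi_apply n).comp measurable_snd))

/-- Resampling one coordinate independently leaves the product law unchanged; this isolates the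
noise of a single step from everything before it. -/
theorem measurePreserving_update (θ : Measure X) [IsProbabilityMeasure θ] (n : ℕ) :
    MeasurePreserving (fun p : (ℕ → X) × X => Function.update p.1 n p.2)
      ((Measure.infinitePi fun _ : ℕ => θ).prod θ) (Measure.infinitePi fun _ : ℕ => θ) := by
  have hmeas : Measurable fun p : (ℕ → X) × X => Function.update p.1 n p.2 := by
    refine measurable_pi_lambda _ fun i => ?_
    by_cases hi : i = n
    · subst hi; simpa using measurable_snd
    · simp only [Function.update_of_ne hi]
      exact (measurable_pi_apply i).comp measurable_fst
  refine ⟨hmeas, Measure.eq_infinitePi _ fun s t ht => ?_⟩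
  rw [Measure.map_apply hmeas (.pi s.countable_toSet fun i _ => ht i)]
  have hset : (fun p : (ℕ → X) × X => Function.update p.1 n p.2) ⁻¹' (Set.pi s t) =
      (Set.pi (s.erase n) t) ×ˢ (if n ∈ s then t n else univ) := by
    ext ⟨w, v⟩
    simp only [mem_preimage, Set.mem_pi, Finset.mem_coe, mem_prod, Finset.mem_erase]
    constructor
    · refine fun H => ⟨fun i hi => by simpa [hi.1] using H i hi.2, ?_⟩
      split_ifs with hn
      · simpa using H n hn
      · trivial
    · rintro ⟨H1, H2⟩ i hi
      by_cases hin : i = n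
      · subst hin; simpa [hi] using H2
      · simpa [hin] using H1 i ⟨hin, hi⟩
  rw [hset, Measure.prod_prod, Measure.infinitePi_pi _ (fun i _ => ht i)]
  split_ifs with hn
  · exact Finset.prod_erase_mul _ _ hn
  · rw [measure_univ, mul_one, Finset.erase_eq_of_notMem hn]

omit [MeasurableSpace M] [MeasurableSpace X] in
theorem randomOrbit_update (w : ℕ → X) {n i : ℕ} (hi : i ≤ n) (v : X) (x : M) :
    randomOrbit F (Function.update w n v) i x = randomOrbit F w i x := by
  induction i with
  | zero => rfl
  | succ i ih =>
    have : i ≠ n := by omega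
    simp [randomOrbit, ih (by omega), this]

/-- The random orbits, started with distribution `μ`, are a Markov chain. -/
theorem isMarkovChain_randomOrbit (hF : Measurable (Function.uncurry F)) (θ : Measure X)
    [IsProbabilityMeasure θ] (μ : Measure M) [IsProbabilityMeasure μ] :
    IsMarkovChain (fun x => θ.map (F x)) μ (μ.prod (Measure.infinitePi fun _ : ℕ => θ))
      (fun n z => randomOrbit F z.2 n z.1) := by
  refine ⟨inferInstance, measurable_randomOrbit hF, ?_, fun n B A hB hA => ?_⟩
  · change Measure.map Prod.fst _ = _
    simp
  set Q := μ.prod (Measure.infinitePi fun _ : ℕ => θ)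
  have hS : MeasurableSet {z : M × (ℕ → X) |
      (fun i : Fin (n + 1) => randomOrbit F z.2 i z.1) ∈ B} :=
    hB.preimage (measurable_pi_lambda _ fun i => measurable_randomOrbit hF i)
  have hE : MeasurableSet {z : M × (ℕ → X) |
      (fun i : Fin (n + 1) => randomOrbit F z.2 i z.1) ∈ B ∧
        randomOrbit F z.2 (n + 1) z.1 ∈ A} :=
    hS.inter (hA.preimage (measurable_randomOrbit hF (n + 1)))
  -- After coordinate n is resampled, the states up to time n are unaffected and the next one
  -- depends on the fresh noise, so Fubini gives the transition probability.
  have hΦ := ((MeasurePreserving.id μ).prod (measurePreserving_update θ n)).comp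
    (measurePreserving_prodAssoc μ (Measure.infinitePi fun _ : ℕ => θ) θ)
  rw [← hΦ.measure_preimage hE.nullMeasurableSet,
    Measure.prod_apply (hΦ.measurable hE), ← lintegral_indicator hS]
  refine lintegral_congr fun z => ?_
  have hslice : Prod.mk z ⁻¹' ((Prod.map id (fun p : (ℕ → X) × X => Function.update p.1 n p.2) ∘
      MeasurableEquiv.prodAssoc) ⁻¹' {z : M × (ℕ → X) |
      (fun i : Fin (n + 1) => randomOrbit F z.2 i z.1) ∈ B ∧
        randomOrbit F z.2 (n + 1) z.1 ∈ A}) =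
      {v | (fun i : Fin (n + 1) => randomOrbit F z.2 i z.1) ∈ B ∧
        F (randomOrbit F z.2 n z.1) v ∈ A} := by
    ext v
    have h1 : ∀ i : Fin (n + 1), randomOrbit F (Function.update z.2 n v) i z.1 =
        randomOrbit F z.2 i z.1 := fun i =>
      randomOrbit_update z.2 (Nat.lt_succ_iff.1 i.2) v z.1
    have h2 : randomOrbit F (Function.update z.2 n v) (n + 1) z.1 =
        F (randomOrbit F z.2 n z.1) v := by
      simp [randomOrbit, randomOrbit_update z.2 le_rfl v z.1]
    change ((fun i : Fin (n + 1) => randomOrbit F (Function.update z.2 n v) i z.1) ∈ B ∧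
      randomOrbit F (Function.update z.2 n v) (n + 1) z.1 ∈ A) ↔ _
    simp only [h1, h2]
    rfl
  rw [hslice]
  by_cases hz : (fun i : Fin (n + 1) => randomOrbit F z.2 i z.1) ∈ B
  · refine Eq.trans ?_ (indicator_of_mem (s := {z : M × (ℕ → X) |
      (fun i : Fin (n + 1) => randomOrbit F z.2 i z.1) ∈ B}) hz _).symm
    simp only [hz, true_and]
    exact (Measure.map_apply (hF.comp measurable_prodMk_left) hA).symm
  · refine Eq.trans ?_ (indicator_of_notMem (s := {z : M × (ℕ → X) |
      (fun i : Fin (n + 1) => randomOrbit F z.2 i z.1) ∈ B}) hz _).symm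
    simp only [hz, false_and]
    exact measure_empty

end RandomMaps

/-! ### Both kinds of perturbation yield noisy kernels. -/

section Perturbations

variable {M : Type*} [MetricSpace M] [MeasurableSpace M] [BorelSpace M] [CompactSpace M]
  {m : Measure M} {f : M → M}

theorem IsRandomPerturbation.exists_isNoisyKernel {X : Type*} [PseudoMetricSpace X]
    [MeasurableSpace X] {F : M → X → M} {ωstar : X} {θ : Measure X}
    (h : IsRandomPerturbation m f F ωstar θ) (κ : Kernel M M) (hκ : ∀ x, κ x = θ.map (F x)) :
    ∃ r qlow qup, IsNoisyKernel κ m f r qlow qup := by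
  obtain ⟨ρ₀, hρ₀, hcover⟩ := h.cover
  obtain ⟨qlow, qup, hlow, -, hdens⟩ := h.density
  -- If y is within 3r of f(x), then B(y, r) lies in B(f(x), 4r), which is the ball of radius ρ₀.
  refine ⟨ρ₀ / 4, qlow.toNNReal, qup.toNNReal, by positivity, by simpa using hlow, ?_, ?_⟩
  · filter_upwards [hdens] with x ⟨q, hq, hqm, hqb⟩ A hA
    have hsm : MeasurableSet (θ.map (F x)).support := Measure.isClosed_support.measurableSet
    rw [hκ]
    -- The density is controlled only on the support, whose complement carries no mass.
    calc θ.map (F x) A ≤ θ.map (F x) (A ∩ (θ.map (F x)).support) := by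
          refine (measure_mono (fun y hy => ?_)).trans (measure_union_le
            (A ∩ (θ.map (F x)).support) (θ.map (F x)).supportᶜ) |>.trans_eq ?_
          · by_cases hys : y ∈ (θ.map (F x)).support
            · exact Or.inl ⟨hy, hys⟩
            · exact Or.inr hys
          · rw [Measure.measure_compl_support, add_zero]
      _ = ∫⁻ y in A ∩ (θ.map (F x)).support, ENNReal.ofReal (q y) ∂m := by
          rw [← withDensity_apply _ (hA.inter hsm), ← hqm]
      _ ≤ ∫⁻ _ in A ∩ (θ.map (F x)).support, ENNReal.ofReal qup ∂m := by
          refine setLIntegral_mono_ae' (hA.inter hsm) ?_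
          filter_upwards [hqb] with y hy hyA
          exact ENNReal.ofReal_le_ofReal (hy hyA.2).2
      _ ≤ _ := by
          rw [setLIntegral_const]
          exact mul_le_mul_right (measure_mono inter_subset_left) _
  · filter_upwards [hdens, hcover] with x ⟨q, hq, hqm, hqb⟩ hx y hy
    have hball : Metric.ball y (ρ₀ / 4) ⊆ (θ.map (F x)).support := by
      refine Subset.trans (Metric.ball_subset_ball' ?_) hx
      rw [dist_comm]; linarith
    refine Measure.le_intro fun A hA _ => ?_
    have hm := hA.inter (Metric.isOpen_ball (x := y) (ε := ρ₀ / 4)).measurableSet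
    rw [hκ, Measure.smul_apply, Measure.restrict_apply hA, smul_eq_mul, ← setLIntegral_const]
    calc _ ≤ ∫⁻ y in A ∩ Metric.ball y (ρ₀ / 4), ENNReal.ofReal (q y) ∂m := by
          refine setLIntegral_mono_ae' hm ?_
          filter_upwards [hqb] with z hz hzA
          exact ENNReal.ofReal_le_ofReal (hz (hball hzA.2)).1
      _ = θ.map (F x) (A ∩ Metric.ball y (ρ₀ / 4)) := by
          rw [hqm, withDensity_apply _ hm]
      _ ≤ _ := measure_mono inter_subset_left

variable {Y : Set M} {q : C(M, C(M, ℝ))}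

theorem measurable_densityTransition [IsFiniteMeasure m] :
    Measurable (densityTransition m q) := by
  have hcont : Continuous fun p : M × M => q p.1 p.2 :=
    ContinuousMap.continuous_uncurry_of_continuous q
  refine Measure.measurable_of_measurable_coe _ fun A hA => ?_
  simp only [densityTransition, withDensity_apply _ hA]
  exact Measurable.lintegral_prod_right' (ν := m.restrict A)
    (f := fun p : M × M => ENNReal.ofReal (q p.1 p.2)) hcont.measurable.ennreal_ofReal

theorem IsMarkovPerturbation.isProbabilityMeasure [IsFiniteMeasure m]
    (h : IsMarkovPerturbation m f Y q) (x : M) :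
    IsProbabilityMeasure (densityTransition m q x) := by
  refine ⟨?_⟩
  have hint : Integrable (q x) m :=
    (q x).continuous.integrable_of_hasCompactSupport (HasCompactSupport.of_compactSpace _)
  rw [densityTransition, withDensity_apply _ .univ, Measure.restrict_univ,
    ← ofReal_integral_eq_lintegral_ofReal hint (Eventually.of_forall fun y => (h.pos x y).le),
    h.prob x, ENNReal.ofReal_one]

omit [BorelSpace M] [CompactSpace M] in
theorem IsMarkovPerturbation.exists_isNoisyKernel (h : IsMarkovPerturbation m f Y q)
    (hY : ∀ᵐ x ∂m, x ∈ Y) (κ : Kernel M M) (hκ : ∀ x, κ x = densityTransition m q x) :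
    ∃ r qlow qup, IsNoisyKernel κ m f r qlow qup := by
  obtain ⟨qlow, qup, hlow, -, hb⟩ := h.bounds
  -- Any radius works, since the density bounds hold on all of M.
  refine ⟨1, qlow.toNNReal, qup.toNNReal, one_pos, by simpa using hlow, ?_, ?_⟩
  · filter_upwards [hY] with x hx A hA
    rw [hκ, densityTransition, withDensity_apply _ hA, ← setLIntegral_const]
    exact lintegral_mono fun y => ENNReal.ofReal_le_ofReal (hb x hx y).2
  · filter_upwards [hY] with x hx y _
    refine Measure.le_intro fun A hA _ => ?_
    rw [hκ, Measure.smul_apply, smul_eq_mul, densityTransition, withDensity_apply _ hA]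
    calc _ ≤ (qlow.toNNReal : ℝ≥0∞) * m A := by gcongr; exact Measure.restrict_le_self
      _ = ∫⁻ _ in A, ENNReal.ofReal qlow ∂m := by rw [setLIntegral_const]; rfl
      _ ≤ _ := lintegral_mono fun y => ENNReal.ofReal_le_ofReal (hb x hx y).1

end Perturbations

end RandomEVL

theorem theoremC {d : ℕ} {M : Type*} [MetricSpace M]
    [ChartedSpace (EuclideanSpace ℝ (Fin d)) M] [IsManifold (𝓡 d) ∞ M]
    [Bundle.RiemannianBundle (fun x : M => TangentSpace (𝓡 d) x)]
    [IsContMDiffRiemannianBundle (𝓡 d) ∞ (EuclideanSpace ℝ (Fin d))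
      (fun x : M => TangentSpace (𝓡 d) x)]
    [IsRiemannianManifold (𝓡 d) M] [CompactSpace M] [ConnectedSpace M]
    [MeasurableSpace M] [BorelSpace M]
    -- the normalised volume and the transitive map
    (Leb : Measure M) (hLeb : IsNormalizedVolume d Leb)
    (f : M → M) (Y : Set M) (hY : ∀ᵐ x ∂Leb, x ∈ Y) (hfY : ContinuousOn f Y)
    (x₀ : M) (hdense : DenseRange fun n : ℕ => f^[n] x₀) (horbit : ∀ n : ℕ, f^[n] x₀ ∈ Y)
    -- the stationary measure and the observable
    (μ : Measure M) [IsProbabilityMeasure μ]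
    (ζ : M) (φ : M → EReal) (hφ : IsRegularObservable d μ φ ζ) :
    -- perturbation by random maps
    (∀ (X : Type*) [MetricSpace X] [CompactSpace X] [MeasurableSpace X] [BorelSpace X]
      (F : M → X → M) (ωstar : X) (θ : Measure X),
      IsRandomPerturbation Leb f F ωstar θ →
      IsStationaryMeasure (fun x => θ.map (F x)) μ →
      (∀ᵐ x ∂μ, θ.map (F x) ≪ Leb) →
      ExponentialExtremes (μ.prod (Measure.infinitePi fun _ : ℕ => θ))
        (fun n z => φ (randomOrbit F z.2 n z.1))) ∧
    -- perturbation by a Markov chain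
    (∀ q : C(M, C(M, ℝ)), IsMarkovPerturbation Leb f Y q →
      IsStationaryMeasure (densityTransition Leb q) μ →
      ∀ (Ω : Type*) [MeasurableSpace Ω] (P : Measure Ω) (Z : ℕ → Ω → M),
        IsMarkovChain (densityTransition Leb q) μ P Z →
        ExponentialExtremes P (fun n w => φ (Z n w))) := by
  have hprob := hLeb.prob
  have hopen := hLeb.isOpenPosMeasure
  refine ⟨fun X _ _ _ _ F ωstar θ hF hμ hac => ?_, fun q hq hμ Ω _ P Z hZ => ?_⟩
  · have hθ := hF.prob
    let κ : ProbabilityTheory.Kernel M M := ⟨_, measurable_transition hF.measurable θ⟩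
    have hκ : ProbabilityTheory.IsMarkovKernel κ := ⟨fun x =>
      Measure.isProbabilityMeasure_map (hF.measurable.comp measurable_prodMk_left).aemeasurable⟩
    obtain ⟨r, qlow, qup, hnoise⟩ := hF.exists_isNoisyKernel κ fun _ => rfl
    have htrans : IsTransitiveNoise κ Leb f Y x₀ r qlow qup :=
      ⟨hnoise, hY, hfY, hdense, horbit⟩
    exact htrans.exponentialExtremes hμ hac hφ
      (isMarkovChain_randomOrbit hF.measurable θ μ)
  · let κ : ProbabilityTheory.Kernel M M := ⟨_, measurable_densityTransition (m := Leb) (q := q)⟩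
    have hκ : ProbabilityTheory.IsMarkovKernel κ := ⟨hq.isProbabilityMeasure⟩
    obtain ⟨r, qlow, qup, hnoise⟩ := hq.exists_isNoisyKernel hY κ fun _ => rfl
    have htrans : IsTransitiveNoise κ Leb f Y x₀ r qlow qup :=
      ⟨hnoise, hY, hfY, hdense, horbit⟩
    exact htrans.exponentialExtremes hμ
      (Eventually.of_forall fun x => withDensity_absolutelyContinuous _ _) hφ hZ
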